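/- Let $(X,J)=\{(X_n,J_n)\}_{n\ge 0}$ be a discrete-time Markov additive chain with level $X_n\in\mathbb{Z}$ and phase $J_n$ in a finite set $E$, with laws $\mathbb{P}_{x,i}=\mathbb{P}(\,\cdot\mid X_0=x,J_0=i)$: for every $T\ge 0$ and $j\in E$, given $\{J_T=j\}$, the process $\{(X_{T+n}-X_T,J_{T+n})\}_{n\ge0}$ is independent of $\sigma((X_k,J_k):k\le T)$ and has the law of $\{(X_n-X_0,J_n)\}_{n\ge0}$ given $J_0=j$. Put $\mathbf{P}_{ij}=\mathbb{P}(J_1=j\mid J_0=i)$ and $(\mathbf{A}_m)_{ij}=\mathbb{P}_{0,i}(X_1=m,\,J_1=j)$. Assume that $\mathbf{P}$ is irreducible and that the chain is upward skip-free, i.e. $\mathbf{A}_m=0$ for $m\ge 2$. Let $\boldsymbol{\pi}$ be the stationary distribution of $\mathbf{P}$, let $\mathbf{e}$ be the vector of ones, let $\mathbb{E}^{\boldsymbol{\pi}}(X_1)=\sum_{i}\pi_i\,\mathbb{E}(X_1\mid X_0=0,J_0=i)\in[-\infty,1]$, and let $\mathbf{F}(z)=\sum_{m=-1}^\infty z^m\mathbf{A}_{-m}$,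 on the set $D$ of those $z>0$ for which the series converges. Let $\kappa(z)$ be the Perron–Frobenius eigenvalue of $\mathbf{F}(z)$, i.e. the largest absolute value of its complex eigenvalues. Then $(0,1]\subseteq D$, for every $z\in D$ the number $\kappa(z)$ is itself an eigenvalue of $\mathbf{F}(z)$, and $\kappa$ has a derivative $\kappa'(1)\in(-\infty,+\infty]$ at $1$ within $D$ (that is, the left derivative if $D=(0,1]$, and the usual derivative if $D$ is a neighbourhood of $1$; the value $+\infty$ means that the difference quotients tend to $+\infty$, and is attained exactly when $\mathbb{E}^{\boldsymbol{\pi}}(X_1)=-\infty$). Moreover, $\mathbb{P}_{x,i}$-almost surely for every $x\in\mathbb{Z}$ and $i\in E$, $$\lim_{n\to\infty}\frac{X_n}{n}=-\kappa'(1)=\mathbb{E}^{\boldsymbol{\pi}}(X_1)=-\boldsymbol{\pi}^\top\sum_{m=-1}^\infty m\,\mathbf{A}_{-m}\mathbf{e},$$ as an identity in $[-\infty,\infty)$. Furthermore, $\mathbb{P}_{x,i}$-almost surely for every $x\in\mathbb{Z}$ and $i\in E$: 1. if $\kappa'(1)<0$, i.e. $\boldsymbol{\pi}^\top\mathbf{A}_1\mathbf{e}>\sum_{m=1}^\infty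 m\,\boldsymbol{\pi}^\top\mathbf{A}_{-m}\mathbf{e}$, then $X_n\to+\infty$; 2. if $\kappa'(1)>0$, i.e. $\boldsymbol{\pi}^\top\mathbf{A}_1\mathbf{e}<\sum_{m=1}^\infty m\,\boldsymbol{\pi}^\top\mathbf{A}_{-m}\mathbf{e}$, then $X_n\to-\infty$; 3. if $\kappa'(1)=0$, i.e. $\boldsymbol{\pi}^\top\mathbf{A}_1\mathbf{e}=\sum_{m=1}^\infty m\,\boldsymbol{\pi}^\top\mathbf{A}_{-m}\mathbf{e}$, and the chain is not degenerate, then $X_n$ oscillates: $\limsup_{n}X_n=+\infty$ and $\liminf_{n}X_n=-\infty$. Here the chain is called degenerate if there is $g:E\to\mathbb{Z}$ with $X_1-X_0=g(J_1)-g(J_0)$ $\mathbb{P}_{0,i}$-almost surely for every $i\in E$. -/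

import Mathlib

open MeasureTheory Filter Topology Matrix
open scoped ENNReal

/-- A discrete-time Markov additive chain `(X, J)` with level `X n ∈ ℤ` and phase `J n ∈ E`,
together with its family of laws `law x i = ℙ(· | X₀ = x, J₀ = i)`. -/
structure MarkovAdditiveChain (Ω E : Type*) [MeasurableSpace Ω] [MeasurableSpace E] where
  /-- the level process -/
  X : ℕ → Ω → ℤ
  /-- the phase process -/
  J : ℕ → Ω → E
  /-- the law of the chain started from level `x` and phase `i` -/
  law : ℤ → E → Measure Ω
  measurable_X : ∀ n, Measurable (X n)
  measurable_J : ∀ n, Measurable (J n)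
  isProbabilityMeasure_law : ∀ x i, IsProbabilityMeasure (law x i)
  start : ∀ x i, ∀ᵐ ω ∂(law x i), X 0 ω = x ∧ J 0 ω = i
  /-- The Markov additive property: given `J_T = j`, the process `(X_{T+n} - X_T, J_{T+n})_n` is
  independent of the history `σ((X_k, J_k) : k ≤ T)`, with the law of `(X_n - X_0, J_n)_n` given
  `J_0 = j`. -/
  markov_additive : ∀ (x : ℤ) (i : E) (T : ℕ) (j : E) (B : Set Ω) (C : Set (ℕ → ℤ × E)),
    MeasurableSet[⨆ k ≤ T, MeasurableSpace.comap (fun ω => (X k ω, J k ω)) inferInstance] B →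
    MeasurableSet C →
    law x i (B ∩ {ω | J T ω = j} ∩ {ω | (fun n => (X (T + n) ω - X T ω, J (T + n) ω)) ∈ C}) =
      law x i (B ∩ {ω | J T ω = j}) * law 0 j {ω | (fun n => (X n ω - X 0 ω, J n ω)) ∈ C}

namespace MarkovAdditiveChain

variable {Ω E : Type*} [MeasurableSpace Ω] [MeasurableSpace E]

/-- The transition matrix `P` of the phase process, `P i j = ℙ(J₁ = j | J₀ = i)`. -/
noncomputable def P (M : MarkovAdditiveChain Ω E) : Matrix E E ℝ :=
  Matrix.of fun i j => (M.law 0 i).real {ω | M.J 1 ω = j}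

/-- The block `A_m`, `(A_m) i j = ℙ(X₁ = m, J₁ = j | X₀ = 0, J₀ = i)`. -/
noncomputable def A (M : MarkovAdditiveChain Ω E) (m : ℤ) : Matrix E E ℝ :=
  Matrix.of fun i j => (M.law 0 i).real {ω | M.X 1 ω = m ∧ M.J 1 ω = j}

/-- The chain is upward skip-free ("spectrally negative"): no upward jump exceeds one. -/
def IsUpwardSkipFree (M : MarkovAdditiveChain Ω E) : Prop :=
  ∀ m : ℤ, 2 ≤ m → M.A m = 0

/-- The matrix generating function `F(z) = ∑_{m ≥ -1} z ^ m A_{-m}` (with `m = k - 1`, `k ∈ ℕ`). -/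
noncomputable def F (M : MarkovAdditiveChain Ω E) (z : ℝ) : Matrix E E ℝ :=
  Matrix.of fun i j => ∑' k : ℕ, z ^ ((k : ℤ) - 1) * M.A (1 - (k : ℤ)) i j

/-- The set of the `z > 0` at which (all entries of) the series `F(z)` converge. -/
def domF (M : MarkovAdditiveChain Ω E) : Set ℝ :=
  {z | 0 < z ∧ ∀ i j, Summable fun k : ℕ => z ^ ((k : ℤ) - 1) * M.A (1 - (k : ℤ)) i j}

end MarkovAdditiveChain

/-- The Perron–Frobenius eigenvalue of a nonnegative square matrix: the largest absolute value of
its complex eigenvalues. -/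
noncomputable def perronFrobeniusEigenvalue {E : Type*} [Fintype E] [DecidableEq E]
    (B : Matrix E E ℝ) : ℝ :=
  (spectralRadius ℂ (B.map ((↑) : ℝ → ℂ))).toReal

/-- `π` is a stationary probability vector of the stochastic matrix `P`. -/
structure IsStationaryDistribution {E : Type*} [Fintype E] (P : Matrix E E ℝ) (π : E → ℝ) :
    Prop where
  nonneg : ∀ i, 0 ≤ π i
  sum_eq_one : ∑ i, π i = 1
  stationary : π ᵥ* P = π

/-- The expectation of `Y`, with values in `[-∞, ∞]`: `𝔼 Y⁺ - 𝔼 Y⁻`. It is only used for `Y`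
that are almost surely bounded above. -/
noncomputable def extExpectation {Ω : Type*} [MeasurableSpace Ω] (μ : Measure Ω) (Y : Ω → ℝ) :
    EReal :=
  ((∫⁻ ω, ENNReal.ofReal (Y ω) ∂μ : ℝ≥0∞) : EReal) -
    ((∫⁻ ω, ENNReal.ofReal (-Y ω) ∂μ : ℝ≥0∞) : EReal)

/-- `f` has derivative `d` at `x` within `s`, where the values `±∞` are allowed for `d`. -/
def HasExtDerivWithinAt (f : ℝ → ℝ) (d : EReal) (s : Set ℝ) (x : ℝ) : Prop :=
  Tendsto (fun y => ((slope f x y : ℝ) : EReal)) (𝓝[s \ {x}] x) (𝓝 d)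

/-- For a finite value this is Mathlib's notion of derivative. -/
theorem hasExtDerivWithinAt_coe_iff (f : ℝ → ℝ) (d : ℝ) (s : Set ℝ) (x : ℝ) :
    HasExtDerivWithinAt f (d : EReal) s x ↔ HasDerivWithinAt f d s x := by
  rw [hasDerivWithinAt_iff_tendsto_slope]
  exact EReal.tendsto_coe

namespace MarkovAdditiveChain

variable {Ω E : Type*} [MeasurableSpace Ω] [MeasurableSpace E]

/-- `κ(z)`, the Perron–Frobenius eigenvalue of `F(z)`. -/
noncomputable def κ [Fintype E] [DecidableEq E] (M : MarkovAdditiveChain Ω E) (z : ℝ) : ℝ :=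
  perronFrobeniusEigenvalue (M.F z)

/-- `𝔼^α(X₁) = ∑ i, α i * 𝔼(X₁ | X₀ = 0, J₀ = i)`, with values in `[-∞, ∞]`. -/
noncomputable def meanX₁ [Fintype E] (M : MarkovAdditiveChain Ω E) (α : E → ℝ) : EReal :=
  ∑ i, (α i : EReal) * extExpectation (M.law 0 i) (fun ω => (M.X 1 ω : ℝ))

/-- The sum `∑_{m ≥ 1} m πᵀ A_{-m} e` of nonnegative terms (the term `m = 0` vanishes). -/
noncomputable def meanDown [Fintype E] (M : MarkovAdditiveChain Ω E) (π : E → ℝ) : ℝ≥0∞ :=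
  ∑' m : ℕ, (m : ℝ≥0∞) * ENNReal.ofReal (π ⬝ᵥ (M.A (-(m : ℤ)) *ᵥ 1))

/-- `πᵀ A_1 e`. -/
noncomputable def meanUp [Fintype E] (M : MarkovAdditiveChain Ω E) (π : E → ℝ) : ℝ :=
  π ⬝ᵥ (M.A 1 *ᵥ 1)

/-- `πᵀ (∑_{m ≥ -1} m A_{-m}) e`, in `(-∞, ∞]`: the only negative term, `m = -1`, is split off. -/
noncomputable def driftSum [Fintype E] (M : MarkovAdditiveChain Ω E) (π : E → ℝ) : EReal :=
  (M.meanDown π : EReal) - (M.meanUp π : EReal)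

/-- The level is a deterministic function of the phase up to its starting point:
`X₁ - X₀ = g(J₁) - g(J₀)` almost surely, for some `g : E → ℤ`. -/
def IsDegenerate (M : MarkovAdditiveChain Ω E) : Prop :=
  ∃ g : E → ℤ, ∀ i, ∀ᵐ ω ∂(M.law 0 i), M.X 1 ω - M.X 0 ω = g (M.J 1 ω) - g (M.J 0 ω)

end MarkovAdditiveChain

/-! Law of large numbers. On the space of recentred paths, the shift that restarts the path at time
1 preserves the law with initial phase distribution `π`. The probability of a shift-invariant event,
as a function of the initial phase, is harmonic for the irreducible matrix `P`, hence constant; the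
event is then independent of every finite history, so of itself, and the shift is ergodic
(`ergodic_recenter`). The level is the Birkhoff sum of the one-step increment, so Birkhoff's
theorem, extended by truncation to mean `-∞` (`Ergodic.ae_tendsto_birkhoffSum_div_extExpectation`),
gives the limit of `X n / n`. Since `π` is positive, the conclusion holds from every phase.

Derivative. Pairing `F(z) v = κ(z) v` with `π` gives `(κ(z) - 1) π·v = π·(F(z) - P) v`. Dividing by
`z - 1` writes the slope of `κ` as a weighted combination of slopes of the entries of `F`
(`exists_slope_κ_eq`). By compactness the normalised eigenvectors converge to a constant vector
(`tendsto_eigenvector`), so the weights converge. The entries are power series with nonnegative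
coefficients plus a term in `z⁻¹`, so their slopes converge to first moments, finite or infinite. No
perturbation theory is involved, and one-sided, two-sided and infinite derivatives are handled
together.

Zero drift. Times after which the level stays strictly higher have a density, and each raises the
later levels by at least one; sublinear growth forces density zero, so the level does not tend to
`+∞` (`mixedLaw_staysAbove_eq_zero`). If its limit inferior were finite with positive probability,
the probability that it equals `z` from phase `j` would be a harmonic function of `(z, j)` with
finite total mass. Its maximum is attained on a finite set which every possible step translates into
itself fibrewise; counting makes these translations bijections, and comparing largest elements shows
that the increment is a difference of functions of the phase (`isDegenerate_of_extremeLimit`). Both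
arguments apply to `X` and `-X`. -/

/-! ### Perron–Frobenius theory of irreducible matrices -/

section PerronFrobenius

variable {E : Type*}

/-- In an irreducible matrix, a nonempty set of indices closed under the transitions is full. -/
theorem Matrix.IsIrreducible.mem_of_closed {B : Matrix E E ℝ} (hB : B.IsIrreducible) {S : Set E}
    (hne : S.Nonempty) (hS : ∀ i ∈ S, ∀ j, 0 < B i j → j ∈ S) (j : E) : j ∈ S := by
  obtain ⟨i, hi⟩ := hne
  let _ : Quiver E := toQuiver B
  obtain ⟨p, -⟩ := hB.connected i j
  induction p with
  | nil => exact hi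
  | cons q e ih => exact hS _ ih _ e.down

variable [Fintype E]

/-- The support of `π` is nonempty and closed under the transitions of `P`. -/
theorem IsStationaryDistribution.pos {P : Matrix E E ℝ} {π : E → ℝ}
    (hπ : IsStationaryDistribution P π) (hP : P.IsIrreducible) (j : E) : 0 < π j := by
  refine hP.mem_of_closed (S := {j | 0 < π j}) ?_ ?_ j
  · by_contra h
    rw [Set.not_nonempty_iff_eq_empty] at h
    have h0 : ∀ i, π i = 0 := fun i =>
      le_antisymm (not_lt.1 fun hi => (Set.eq_empty_iff_forall_notMem.1 h i) hi) (hπ.nonneg i)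
    have := hπ.sum_eq_one
    simp [h0] at this
  · intro i hi j hij
    have h := congrFun hπ.stationary j
    rw [vecMul, dotProduct] at h
    rw [Set.mem_ofPred_eq, ← h]
    exact Finset.sum_pos' (fun k _ => mul_nonneg (hπ.nonneg k) (hP.nonneg k j))
      ⟨i, Finset.mem_univ i, mul_pos hi hij⟩

/-- The maximum principle: subharmonic functions of an irreducible stochastic matrix are
constant. -/
theorem Matrix.IsIrreducible.eq_of_le_mulVec {P : Matrix E E ℝ} (hP : P.IsIrreducible)
    (h1 : ∀ i, ∑ j, P i j = 1) {u : E → ℝ} (hu : ∀ i, u i ≤ ∑ j, P i j * u j) (i j : E) :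
    u i = u j := by
  have : Nonempty E := ⟨i⟩
  obtain ⟨m, hm⟩ := Finite.exists_max u
  have key : ∀ j, j ∈ {j | u j = u m} := by
    refine hP.mem_of_closed ⟨m, rfl⟩ ?_
    intro a ha b hab
    by_contra hb
    have hb' : u b < u m := lt_of_le_of_ne (hm b) hb
    have : ∑ j, P a j * u j < ∑ j, P a j * u m :=
      Finset.sum_lt_sum (fun c _ => mul_le_mul_of_nonneg_left (hm c) (hP.nonneg a c))
        ⟨b, Finset.mem_univ b, mul_lt_mul_of_pos_left hb' hab⟩
    rw [← Finset.sum_mul, h1 a, one_mul] at this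
    have h2 := hu a
    have h3 : u a = u m := ha
    linarith
  exact (key i).trans (key j).symm

/-- Sum the inequalities over the coordinates. The bound confines the variational problem of
`exists_pos_eigenvector` to a compact set. -/
theorem Matrix.le_sum_of_smul_le_mulVec {B : Matrix E E ℝ} (hB : ∀ i j, 0 ≤ B i j) {x : E → ℝ}
    (hx : x ∈ stdSimplex ℝ E) {t : ℝ} (h : ∀ i, t * x i ≤ (B *ᵥ x) i) : t ≤ ∑ i, ∑ j, B i j := by
  have h1 : t = ∑ i, t * x i := by rw [← Finset.mul_sum, hx.2, mul_one]
  rw [h1]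
  refine Finset.sum_le_sum fun i _ => (h i).trans ?_
  refine Finset.sum_le_sum fun j _ => ?_
  have : x j ≤ 1 := by
    rw [← hx.2]; exact Finset.single_le_sum (fun k _ => hx.1 k) (Finset.mem_univ j)
  simpa using mul_le_mul_of_nonneg_left this (hB i j)

/-- A positive matrix maps nonnegative nonzero vectors to positive ones. -/
theorem Matrix.mulVec_pos_of_pos {S : Matrix E E ℝ} (hS : ∀ i j, 0 < S i j) {w : E → ℝ}
    (hw : ∀ i, 0 ≤ w i) (hw0 : w ≠ 0) (i : E) : 0 < (S *ᵥ w) i := by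
  obtain ⟨j, hj⟩ := Function.ne_iff.1 hw0
  exact Finset.sum_pos' (fun k _ => mul_nonneg (hS i k).le (hw k))
    ⟨j, Finset.mem_univ j, mul_pos (hS i j) (lt_of_le_of_ne (hw j) (Ne.symm hj))⟩

/-- As `π` is a left eigenvector of `P` for the eigenvalue 1, pairing with it isolates `r - 1`. This
serves both for the convergence of eigenvalues and for the exact slope formula of `κ`. -/
theorem IsStationaryDistribution.eigenvalue_sub_one_mul {P B : Matrix E E ℝ} {π : E → ℝ}
    (hπ : IsStationaryDistribution P π) {v : E → ℝ} {r : ℝ} (h : B *ᵥ v = r • v) :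
    (r - 1) * (π ⬝ᵥ v) = π ⬝ᵥ ((B - P) *ᵥ v) := by
  rw [sub_mulVec, dotProduct_sub, h, dotProduct_mulVec π P v, hπ.stationary, dotProduct_smul,
    smul_eq_mul]
  ring

theorem tendsto_dotProduct {ι : Type*} {l : Filter ι} {u v : ι → E → ℝ} {x y : E → ℝ}
    (hu : Tendsto u l (𝓝 x)) (hv : Tendsto v l (𝓝 y)) :
    Tendsto (fun z => u z ⬝ᵥ v z) l (𝓝 (x ⬝ᵥ y)) :=
  tendsto_finsetSum _ fun j _ => (tendsto_pi_nhds.1 hu j).mul (tendsto_pi_nhds.1 hv j)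

theorem tendsto_mulVec {ι : Type*} {l : Filter ι} {B : ι → Matrix E E ℝ} {P : Matrix E E ℝ}
    {v : ι → E → ℝ} {y : E → ℝ} (hB : ∀ i j, Tendsto (fun z => B z i j) l (𝓝 (P i j)))
    (hv : Tendsto v l (𝓝 y)) : Tendsto (fun z => B z *ᵥ v z) l (𝓝 (P *ᵥ y)) :=
  tendsto_pi_nhds.2 fun i => tendsto_dotProduct (tendsto_pi_nhds.2 (hB i)) hv

/-- Normalised eigenvectors of matrices converging to an irreducible stochastic matrix converge
to the normalised constant vector. -/
theorem tendsto_eigenvector [Nonempty E] {ι : Type*} {l : Filter ι} {P : Matrix E E ℝ}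
    (hP : P.IsIrreducible) (h1 : ∀ i, ∑ j, P i j = 1) {π : E → ℝ}
    (hπ : IsStationaryDistribution P π) {B : ι → Matrix E E ℝ} {r : ι → ℝ} {v : ι → E → ℝ}
    (hB : ∀ i j, Tendsto (fun z => B z i j) l (𝓝 (P i j)))
    (hv : ∀ᶠ z in l, v z ∈ stdSimplex ℝ E) (h : ∀ᶠ z in l, B z *ᵥ v z = r z • v z) :
    Tendsto v l (𝓝 fun _ => ((Fintype.card E : ℝ))⁻¹) := by
  refine (isCompact_stdSimplex ℝ E).tendsto_nhds_of_unique_mapClusterPt hv ?_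
  intro y hy hcl
  obtain ⟨U, hUl, hU⟩ := mapClusterPt_iff_ultrafilter.1 hcl
  have hπy : ∀ w ∈ stdSimplex ℝ E, 0 < π ⬝ᵥ w := by
    intro w hw
    have hne : ∃ i, w i ≠ 0 := by
      by_contra hcon
      push Not at hcon
      have := hw.2
      simp [hcon] at this
    obtain ⟨i, hi⟩ := hne
    exact Finset.sum_pos' (fun k _ => mul_nonneg (hπ.nonneg k) (hw.1 k))
      ⟨i, Finset.mem_univ i, mul_pos (hπ.pos hP i) (lt_of_le_of_ne (hw.1 i) (Ne.symm hi))⟩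
  -- Here `r - 1` is a quotient whose numerator tends to 0 and whose denominator tends to `π ⬝ᵥ y >
  -- 0`.
  have hr : Tendsto r U (𝓝 1) := by
    have t1 : Tendsto (fun z => π ⬝ᵥ ((B z - P) *ᵥ v z)) U (𝓝 (π ⬝ᵥ ((P - P) *ᵥ y))) :=
      tendsto_dotProduct tendsto_const_nhds
        (tendsto_mulVec (fun i j => ((hB i j).mono_left hUl).sub_const _) hU)
    have t2 : Tendsto (fun z => π ⬝ᵥ v z) U (𝓝 (π ⬝ᵥ y)) :=
      tendsto_dotProduct tendsto_const_nhds hU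
    have h2 := (t1.div t2 (hπy y hy).ne').add_const 1
    simp only [sub_self, zero_mulVec, dotProduct_zero, zero_div, zero_add] at h2
    refine h2.congr' ?_
    filter_upwards [hUl hv, hUl h] with z hz1 hz2
    rw [Pi.div_apply, ← hπ.eigenvalue_sub_one_mul hz2, mul_div_cancel_right₀ _ (hπy _ hz1).ne']
    ring
  have hPy : P *ᵥ y = y := by
    have t1 : Tendsto (fun z => B z *ᵥ v z) U (𝓝 (P *ᵥ y)) :=
      tendsto_mulVec (fun i j => (hB i j).mono_left hUl) hU
    have t2 : Tendsto (fun z => r z • v z) U (𝓝 ((1 : ℝ) • y)) := hr.smul hU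
    rw [one_smul] at t2
    exact tendsto_nhds_unique (t1.congr' (hUl h)) t2
  have hconst := hP.eq_of_le_mulVec h1 (u := y) (fun i => (congrFun hPy i).ge)
  ext i
  have h3 := hy.2
  rw [Finset.sum_congr rfl fun j _ => hconst j i] at h3
  simp only [Finset.sum_const, Finset.card_univ, nsmul_eq_mul] at h3
  exact eq_inv_of_mul_eq_one_right h3

variable [DecidableEq E]

/-- For each pair of indices some power of `B` has a positive entry there; the sum of these powers
over all pairs is a polynomial in `B`. -/
theorem Matrix.IsIrreducible.exists_pos_commute {B : Matrix E E ℝ} (hB : B.IsIrreducible) :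
    ∃ S : Matrix E E ℝ, (∀ i j, 0 < S i j) ∧ Commute S B := by
  choose k hk0 hk using (isIrreducible_iff_exists_pow_pos hB.nonneg).1 hB
  refine ⟨∑ a, ∑ b, B ^ k a b, fun i j => ?_, ?_⟩
  · rw [Matrix.sum_apply]
    have hnn : ∀ a b, 0 ≤ (B ^ k a b) i j := fun a b => pow_apply_nonneg hB.nonneg _ i j
    refine Finset.sum_pos' (fun a _ => ?_) ⟨i, Finset.mem_univ i, ?_⟩
    · rw [Matrix.sum_apply]; exact Finset.sum_nonneg fun b _ => hnn a b
    · rw [Matrix.sum_apply]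
      exact Finset.sum_pos' (fun b _ => hnn i b) ⟨j, Finset.mem_univ j, hk i j⟩
  · exact Commute.sum_left _ _ _ fun a _ => Commute.sum_left _ _ _ fun b _ =>
      (Commute.refl B).pow_left _

/-- **Perron–Frobenius**: an irreducible matrix has a positive eigenvector. -/
theorem Matrix.IsIrreducible.exists_pos_eigenvector [Nonempty E] {B : Matrix E E ℝ}
    (hB : B.IsIrreducible) :
    ∃ (r : ℝ) (v : E → ℝ), (∀ i, 0 < v i) ∧ ∑ i, v i = 1 ∧ B *ᵥ v = r • v := by
  obtain ⟨S, hS, hSB⟩ := hB.exists_pos_commute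
  set T := ∑ i, ∑ j, B i j
  -- Collatz–Wielandt: the eigenvalue is the largest `t` such that `t x ≤ B x` for some `x` in the
  -- simplex.
  let K : Set ((E → ℝ) × ℝ) := (stdSimplex ℝ E ×ˢ Set.Icc 0 T) ∩
    {p | ∀ i, p.2 * p.1 i ≤ (B *ᵥ p.1) i}
  have hK : IsCompact K := by
    refine ((isCompact_stdSimplex ℝ E).prod isCompact_Icc).inter_right ?_
    rw [Set.ofPred_forall]
    refine isClosed_iInter fun i => isClosed_le (by fun_prop) ?_
    exact (continuous_apply i).comp (Continuous.matrix_mulVec continuous_const continuous_fst)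
  have hne : K.Nonempty := by
    refine ⟨(Pi.single (Classical.arbitrary E) 1, 0), ⟨⟨single_mem_stdSimplex ℝ _, ?_⟩, ?_⟩⟩
    · exact ⟨le_rfl, Finset.sum_nonneg fun i _ => Finset.sum_nonneg fun j _ => hB.nonneg i j⟩
    · intro i
      simp only [zero_mul]
      refine Finset.sum_nonneg fun j _ => mul_nonneg (hB.nonneg i j) ?_
      exact (single_mem_stdSimplex ℝ (Classical.arbitrary E)).1 j
  obtain ⟨⟨x, t⟩, ⟨⟨hx, ht⟩, hxt⟩, hmax⟩ := hK.exists_isMaxOn hne continuous_snd.continuousOn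
  simp only [Set.mem_ofPred_eq] at hxt hx ht
  have hx0 : x ≠ 0 := by
    rintro rfl
    have := hx.2
    simp at this
  have hSx := mulVec_pos_of_pos hS hx.1 hx0
  -- A nonzero defect `B x - t x` becomes strictly positive in all coordinates after applying `S`.
  -- As `S` commutes with `B`, the normalised `S x` then admits a larger `t`.
  have heq : B *ᵥ x = t • x := by
    by_contra hcon
    set w := B *ᵥ x - t • x with hw
    have hSw := mulVec_pos_of_pos hS (w := w) (fun i => by simpa [hw] using hxt i)
      (sub_ne_zero.2 hcon)
    have hSw' : S *ᵥ w = B *ᵥ (S *ᵥ x) - t • (S *ᵥ x) := by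
      rw [hw, mulVec_sub, mulVec_mulVec, mulVec_mulVec, hSB.eq, mulVec_smul]
    obtain ⟨m, hm⟩ := Finite.exists_min fun i => (S *ᵥ w) i / (S *ᵥ x) i
    set ε := (S *ᵥ w) m / (S *ᵥ x) m with hε
    have hε0 : 0 < ε := div_pos (hSw m) (hSx m)
    set c := ∑ i, (S *ᵥ x) i with hc
    have hc0 : 0 < c := Finset.sum_pos (fun i _ => hSx i) Finset.univ_nonempty
    have hy : c⁻¹ • (S *ᵥ x) ∈ stdSimplex ℝ E := by
      refine ⟨fun i => ?_, ?_⟩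
      · exact (mul_pos (inv_pos.2 hc0) (hSx i)).le
      · simp only [Pi.smul_apply, smul_eq_mul]
        rw [← Finset.mul_sum, inv_mul_cancel₀ hc0.ne']
    have hy2 : ∀ i, (t + ε) * (c⁻¹ • (S *ᵥ x)) i ≤ (B *ᵥ (c⁻¹ • (S *ᵥ x))) i := by
      intro i
      have h1 : ε * (S *ᵥ x) i ≤ (S *ᵥ w) i := (le_div_iff₀ (hSx i)).1 (hm i)
      have h2 : (S *ᵥ w) i = (B *ᵥ (S *ᵥ x)) i - t * (S *ᵥ x) i := by
        rw [hSw']; rfl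
      rw [mulVec_smul]
      simp only [Pi.smul_apply, smul_eq_mul]
      have h3 : (t + ε) * (S *ᵥ x) i ≤ (B *ᵥ (S *ᵥ x)) i := by linarith
      calc (t + ε) * (c⁻¹ * (S *ᵥ x) i) = c⁻¹ * ((t + ε) * (S *ᵥ x) i) := by ring
        _ ≤ _ := mul_le_mul_of_nonneg_left h3 (inv_pos.2 hc0).le
    have hmem : (c⁻¹ • (S *ᵥ x), t + ε) ∈ K :=
      ⟨⟨hy, ⟨add_nonneg ht.1 hε0.le, le_sum_of_smul_le_mulVec hB.nonneg hy hy2⟩⟩, hy2⟩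
    have : t + ε ≤ t := hmax hmem
    linarith
  refine ⟨t, x, fun i => ?_, hx.2, heq⟩
  -- Where `x` vanishes, so does every term of `B x`; the zero set of `x` is therefore closed under
  -- the transitions, and nonempty would mean full.
  have hxi : ∀ i, 0 ≤ x i := hx.1
  by_contra hi
  have hi0 : x i = 0 := le_antisymm (not_lt.1 hi) (hxi i)
  have : ∀ j, j ∈ {j | x j = 0} := by
    refine hB.mem_of_closed ⟨i, hi0⟩ ?_
    intro a ha b hab
    have h1 := congrFun heq a
    rw [Pi.smul_apply, smul_eq_mul, show x a = 0 from ha, mul_zero] at h1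
    have h2 := (Finset.sum_eq_zero_iff_of_nonneg
      (fun j _ => mul_nonneg (hB.nonneg a j) (hxi j))).1 h1 b (Finset.mem_univ b)
    exact (mul_eq_zero.1 h2).resolve_left hab.ne'
  exact hx0 (funext this)

/-- For a complex eigenvector `x`, the eigenvalue equation at an index maximising `‖x i‖ / v i`
bounds the modulus of its eigenvalue by `r`, and `r` itself is in the spectrum. -/
theorem perronFrobeniusEigenvalue_eq [Nonempty E] {B : Matrix E E ℝ} (hB : ∀ i j, 0 ≤ B i j)
    {v : E → ℝ} (hv : ∀ i, 0 < v i) {r : ℝ} (h : B *ᵥ v = r • v) :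
    perronFrobeniusEigenvalue B = r := by
  have hr : 0 ≤ r := by
    have h1 := congrFun h (Classical.arbitrary E)
    rw [Pi.smul_apply, smul_eq_mul] at h1
    have h2 : 0 ≤ (B *ᵥ v) (Classical.arbitrary E) :=
      Finset.sum_nonneg fun j _ => mul_nonneg (hB _ j) (hv j).le
    exact nonneg_of_mul_nonneg_left (h1 ▸ h2) (hv _)
  have hspec : ∀ k : ℂ, k ∈ spectrum ℂ (B.map ((↑) : ℝ → ℂ)) ↔
      ∃ x : E → ℂ, x ≠ 0 ∧ B.map ((↑) : ℝ → ℂ) *ᵥ x = k • x := by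
    intro k
    rw [← Matrix.spectrum_toLin', ← Module.End.hasEigenvalue_iff_mem_spectrum]
    constructor
    · intro hk
      obtain ⟨x, hx⟩ := hk.exists_hasEigenvector
      exact ⟨x, hx.2, by simpa using hx.apply_eq_smul⟩
    · rintro ⟨x, hx, hk⟩
      exact Module.End.hasEigenvalue_of_hasEigenvector
        (Module.End.hasEigenvector_iff.2 ⟨Module.End.mem_eigenspace_iff.2 (by simpa using hk), hx⟩)
  have hle : ∀ k : ℂ, k ∈ spectrum ℂ (B.map ((↑) : ℝ → ℂ)) → ‖k‖ ≤ r := by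
    intro k hk
    obtain ⟨x, hx0, hx⟩ := (hspec k).1 hk
    obtain ⟨m, hm⟩ := Finite.exists_max fun i => ‖x i‖ / v i
    set c := ‖x m‖ / v m with hc
    have hcx : ∀ i, ‖x i‖ ≤ c * v i := fun i => (div_le_iff₀ (hv i)).1 (hm i)
    have hc0 : 0 < c := by
      obtain ⟨i, hi⟩ := Function.ne_iff.1 hx0
      exact lt_of_lt_of_le (div_pos (norm_pos_iff.2 hi) (hv i)) (hm i)
    have hxm : ‖x m‖ = c * v m := by rw [hc, div_mul_cancel₀ _ (hv m).ne']
    have h1 : ‖k‖ * (c * v m) ≤ r * (c * v m) := by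
      calc ‖k‖ * (c * v m) = ‖(k • x) m‖ := by rw [← hxm]; simp
        _ = ‖∑ j, (B m j : ℂ) * x j‖ := by rw [← hx]; rfl
        _ ≤ ∑ j, ‖(B m j : ℂ) * x j‖ := norm_sum_le _ _
        _ ≤ ∑ j, B m j * (c * v j) := by
            refine Finset.sum_le_sum fun j _ => ?_
            rw [norm_mul, Complex.norm_real, Real.norm_of_nonneg (hB m j)]
            exact mul_le_mul_of_nonneg_left (hcx j) (hB m j)
        _ = c * (B *ᵥ v) m := by
            rw [mulVec, dotProduct, Finset.mul_sum]
            exact Finset.sum_congr rfl fun j _ => by ring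
        _ = r * (c * v m) := by rw [h, Pi.smul_apply, smul_eq_mul]; ring
    exact le_of_mul_le_mul_right h1 (mul_pos hc0 (hv m))
  have hmem : (r : ℂ) ∈ spectrum ℂ (B.map ((↑) : ℝ → ℂ)) := by
    rw [hspec]
    refine ⟨fun i => (v i : ℂ), ?_, ?_⟩
    · intro h0
      have := congrFun h0 (Classical.arbitrary E)
      simp only [Pi.zero_apply, Complex.ofReal_eq_zero] at this
      exact (hv _).ne' this
    · ext i
      have h1 := congrFun h i
      simp only [mulVec, dotProduct, map_apply, Pi.smul_apply, smul_eq_mul] at h1 ⊢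
      exact_mod_cast congrArg ((↑) : ℝ → ℂ) h1
  have : spectralRadius ℂ (B.map ((↑) : ℝ → ℂ)) = ENNReal.ofReal r := by
    refine le_antisymm (iSup₂_le fun k hk => ?_) ?_
    · rw [← enorm_eq_nnnorm, ← ofReal_norm]
      exact ENNReal.ofReal_le_ofReal (hle k hk)
    · refine le_trans (le_of_eq ?_) (le_iSup₂ (f := fun k (_ : k ∈ spectrum ℂ _) =>
        ((‖k‖₊ : ℝ≥0∞))) (r : ℂ) hmem)
      rw [← enorm_eq_nnnorm, ← ofReal_norm, Complex.norm_real, Real.norm_of_nonneg hr]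
  rw [perronFrobeniusEigenvalue, this, ENNReal.toReal_ofReal hr]

end PerronFrobenius

/-! ### Maximal inequality and Birkhoff's ergodic theorem -/

section ErgodicTheorem

variable {α : Type*} {θ : α → α} {f : α → ℝ}

/-- The maximum of the first Birkhoff sums (including the empty one). -/
def birkhoffMax (θ : α → α) (f : α → ℝ) : ℕ → α → ℝ
  | 0 => fun _ => 0
  | n + 1 => fun x => max 0 (f x + birkhoffMax θ f n (θ x))

theorem birkhoffMax_nonneg (n : ℕ) (x : α) : 0 ≤ birkhoffMax θ f n x := by
  cases n with
  | zero => exact le_rfl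
  | succ n => exact le_max_left _ _

theorem birkhoffMax_le_succ (n : ℕ) (x : α) : birkhoffMax θ f n x ≤ birkhoffMax θ f (n + 1) x := by
  induction n generalizing x with
  | zero => exact le_max_left _ _
  | succ n ih => exact max_le_max le_rfl (by gcongr; exact ih _)

theorem birkhoffSum_le_birkhoffMax (n : ℕ) (x : α) : birkhoffSum θ f n x ≤ birkhoffMax θ f n x := by
  induction n generalizing x with
  | zero => simp [birkhoffMax]
  | succ n ih =>
    rw [birkhoffSum_succ']
    exact le_max_of_le_right (by gcongr; exact ih _)

variable [MeasurableSpace α] {μ : Measure α}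

theorem measurable_birkhoffMax (hθ : Measurable θ) (hf : Measurable f) (n : ℕ) :
    Measurable (birkhoffMax θ f n) := by
  induction n with
  | zero => exact measurable_const
  | succ n ih => exact measurable_const.max (hf.add (ih.comp hθ))

theorem measurable_birkhoffSum (hθ : Measurable θ) (hf : Measurable f) (n : ℕ) :
    Measurable (birkhoffSum θ f n) := by
  induction n with
  | zero => rw [birkhoffSum_zero']; exact measurable_const
  | succ n ih =>
    have : birkhoffSum θ f (n + 1) = fun x => f x + birkhoffSum θ f n (θ x) :=
      funext fun x => birkhoffSum_succ' θ f n x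
    rw [this]
    exact hf.add (ih.comp hθ)

theorem integrable_birkhoffMax [IsFiniteMeasure μ] (hθ : MeasurePreserving θ μ μ)
    (hi : Integrable f μ) (n : ℕ) : Integrable (birkhoffMax θ f n) μ := by
  induction n with
  | zero => exact integrable_zero _ _ _
  | succ n ih => exact (integrable_const (0 : ℝ)).sup (hi.add (hθ.integrable_comp_of_integrable ih))

/-- **The maximal ergodic theorem.** -/
theorem setIntegral_birkhoffMax_nonneg [IsFiniteMeasure μ] (hθ : MeasurePreserving θ μ μ)
    (hf : Measurable f) (hi : Integrable f μ) (n : ℕ) :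
    0 ≤ ∫ x in {x | 0 < birkhoffMax θ f (n + 1) x}, f x ∂μ := by
  have hm := measurable_birkhoffMax hθ.measurable hf
  have hI := integrable_birkhoffMax hθ hi
  have hs : MeasurableSet {x | 0 < birkhoffMax θ f (n + 1) x} :=
    measurableSet_lt measurable_const (hm _)
  have h1 : ∫ x, (birkhoffMax θ f (n + 1) x - birkhoffMax θ f n (θ x)) ∂μ
      ≤ ∫ x in {x | 0 < birkhoffMax θ f (n + 1) x}, f x ∂μ := by
    rw [← integral_indicator hs]
    refine integral_mono ((hI _).sub (hθ.integrable_comp_of_integrable (hI n)))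
      (hi.indicator hs) fun x => ?_
    -- Where the maximum is positive it comes from a nonempty sum, so `f` equals the difference of
    -- the maxima; elsewhere that difference is nonpositive.
    by_cases hx : 0 < birkhoffMax θ f (n + 1) x
    · rw [Set.indicator_of_mem (show x ∈ {x | 0 < birkhoffMax θ f (n + 1) x} from hx)]
      have : birkhoffMax θ f (n + 1) x = f x + birkhoffMax θ f n (θ x) := by
        rcases max_choice 0 (f x + birkhoffMax θ f n (θ x)) with h | h
        · exact absurd (show birkhoffMax θ f (n + 1) x = 0 from h) hx.ne'
        · exact h
      rw [this]; simp
    · rw [Set.indicator_of_notMem (show x ∉ {x | 0 < birkhoffMax θ f (n + 1) x} from hx)]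
      have := birkhoffMax_nonneg (θ := θ) (f := f) n (θ x)
      have := not_lt.1 hx
      simp only
      linarith
  refine le_trans ?_ h1
  have hIθ : Integrable (fun x => birkhoffMax θ f n (θ x)) μ :=
    hθ.integrable_comp_of_integrable (hI n)
  rw [integral_sub (hI _) hIθ, ← integral_map (f := birkhoffMax θ f n) hθ.measurable.aemeasurable
      (hm n).aestronglyMeasurable, hθ.map_eq, sub_nonneg]
  exact integral_mono (hI n) (hI _) fun x => birkhoffMax_le_succ n x

theorem integral_nonneg_of_ae_exists_birkhoffSum_pos [IsFiniteMeasure μ]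
    (hθ : MeasurePreserving θ μ μ) (hf : Measurable f) (hi : Integrable f μ)
    (h : ∀ᵐ x ∂μ, ∃ n, 0 < birkhoffSum θ f n x) : 0 ≤ ∫ x, f x ∂μ := by
  have hm := measurable_birkhoffMax hθ.measurable hf
  set s : ℕ → Set α := fun n => {x | 0 < birkhoffMax θ f (n + 1) x}
  have hs : ∀ n, MeasurableSet (s n) := fun n => measurableSet_lt measurable_const (hm _)
  have hmono : Monotone s := monotone_nat_of_le_succ fun n x hx =>
    lt_of_lt_of_le hx (birkhoffMax_le_succ _ x)
  have h1 := tendsto_setIntegral_of_monotone hs hmono hi.integrableOn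
  have h2 : (⋃ n, s n) =ᵐ[μ] Set.univ := by
    rw [eventuallyEq_univ]
    filter_upwards [h] with x ⟨n, hn⟩
    exact Set.mem_iUnion.2 ⟨n, lt_of_lt_of_le hn
      ((birkhoffSum_le_birkhoffMax n x).trans (birkhoffMax_le_succ n x))⟩
  rw [setIntegral_congr_set h2, setIntegral_univ] at h1
  exact ge_of_tendsto' h1 fun n => setIntegral_birkhoffMax_nonneg hθ hf hi n

/-- Boundedness above is shift invariant, so it holds almost surely or fails almost surely. In the
second case almost every point has a positive sum, and the maximal inequality contradicts the
negative mean. -/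
theorem Ergodic.ae_birkhoffSum_bddAbove [IsProbabilityMeasure μ] (hθ : Ergodic θ μ)
    (hf : Measurable f) (hi : Integrable f μ) (hneg : ∫ x, f x ∂μ < 0) :
    ∀ᵐ x ∂μ, ∃ K : ℕ, ∀ n, birkhoffSum θ f n x ≤ K := by
  set s : Set α := {x | ∃ K : ℕ, ∀ n, birkhoffSum θ f n x ≤ K}
  have hs : MeasurableSet s := by
    have : s = ⋃ K : ℕ, ⋂ n, {x | birkhoffSum θ f n x ≤ K} := by
      ext x; simp [s]
    rw [this]
    exact MeasurableSet.iUnion fun K => MeasurableSet.iInter fun n =>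
      measurableSet_le (measurable_birkhoffSum hθ.measurable hf n) measurable_const
  have hinv : θ ⁻¹' s = s := by
    ext x
    constructor
    · rintro ⟨K, hK⟩
      obtain ⟨K', hK'⟩ := exists_nat_ge (f x + K)
      refine ⟨K', fun n => ?_⟩
      cases n with
      | zero => simp
      | succ n => rw [birkhoffSum_succ']; linarith [hK n]
    · rintro ⟨K, hK⟩
      obtain ⟨K', hK'⟩ := exists_nat_ge (K - f x)
      refine ⟨K', fun n => ?_⟩
      have := hK (n + 1)
      rw [birkhoffSum_succ'] at this
      linarith
  rcases hθ.toPreErgodic.ae_mem_or_ae_notMem hs hinv with h | h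
  · exact h
  · refine absurd (integral_nonneg_of_ae_exists_birkhoffSum_pos hθ.toMeasurePreserving hf hi ?_)
      (not_le.2 hneg)
    filter_upwards [h] with x hx
    by_contra! hcon
    exact hx ⟨0, by simpa using hcon⟩

/-- Subtracting slightly more than the mean leaves a function of negative mean, whose sums are
bounded above; the bound disappears after division by `n`. -/
theorem Ergodic.ae_eventually_birkhoffSum_le [IsProbabilityMeasure μ] (hθ : Ergodic θ μ)
    (hf : Measurable f) (hi : Integrable f μ) :
    ∀ᵐ x ∂μ, ∀ k : ℕ, ∀ᶠ n : ℕ in atTop,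
      birkhoffSum θ f n x / n ≤ ∫ x, f x ∂μ + 2 / ((k : ℝ) + 1) := by
  rw [ae_all_iff]
  intro k
  set c : ℝ := ∫ x, f x ∂μ + 1 / ((k : ℝ) + 1) with hc
  have hk : (0 : ℝ) < 1 / ((k : ℝ) + 1) := by positivity
  have hneg : ∫ x, (f x - c) ∂μ < 0 := by
    rw [integral_sub hi (integrable_const c)]
    simp only [integral_const, probReal_univ, smul_eq_mul, one_mul]
    linarith
  filter_upwards [hθ.ae_birkhoffSum_bddAbove (hf.sub_const c) (hi.sub (integrable_const c)) hneg]
    with x ⟨K, hK⟩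
  have h1 : ∀ n : ℕ, birkhoffSum θ f n x ≤ c * n + K := by
    intro n
    have h2 := hK n
    have h3 : birkhoffSum θ (fun x => f x - c) n x = birkhoffSum θ f n x - n * c := by
      simp [birkhoffSum]
    rw [h3] at h2
    linarith
  have h4 : Tendsto (fun n : ℕ => (K : ℝ) / n) atTop (𝓝 0) :=
    tendsto_const_nhds.div_atTop tendsto_natCast_atTop_atTop
  filter_upwards [h4.eventually (gt_mem_nhds hk), eventually_gt_atTop 0] with n hn hn0
  have hn0' : (0 : ℝ) < n := by exact_mod_cast hn0
  rw [div_le_iff₀ hn0']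
  rw [div_lt_iff₀ hn0'] at hn
  have := h1 n
  have e : (2 : ℝ) / ((k : ℝ) + 1) = 1 / ((k : ℝ) + 1) + 1 / ((k : ℝ) + 1) := by ring
  rw [e]
  rw [hc] at this
  linarith

/-- **Birkhoff's pointwise ergodic theorem** for an ergodic transformation. -/
theorem Ergodic.ae_tendsto_birkhoffSum_div [IsProbabilityMeasure μ] (hθ : Ergodic θ μ)
    (hf : Measurable f) (hi : Integrable f μ) :
    ∀ᵐ x ∂μ, Tendsto (fun n : ℕ => birkhoffSum θ f n x / n) atTop (𝓝 (∫ x, f x ∂μ)) := by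
  filter_upwards [hθ.ae_eventually_birkhoffSum_le hf hi,
    hθ.ae_eventually_birkhoffSum_le hf.neg hi.neg] with x h1 h2
  rw [Metric.tendsto_atTop']
  intro ε hε
  obtain ⟨k, hk⟩ := exists_nat_one_div_lt (half_pos hε)
  obtain ⟨N, hN⟩ := eventually_atTop.1 ((h1 k).and (h2 k))
  refine ⟨N, fun n hn => ?_⟩
  obtain ⟨h3, h4⟩ := hN n hn.le
  rw [birkhoffSum_neg] at h4
  simp only [Pi.neg_apply, integral_neg] at h4
  have e : (2 : ℝ) / ((k : ℝ) + 1) = 2 * (1 / ((k : ℝ) + 1)) := by ring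
  rw [e] at h3 h4
  rw [neg_div] at h4
  rw [Real.dist_eq, abs_lt]
  constructor <;> linarith

end ErgodicTheorem

/-! ### Path space, recentred shift and path laws -/

theorem MeasureTheory.measure_eq_sum_inter_preimage_singleton {α E : Type*} [MeasurableSpace α]
    [Fintype E] [MeasurableSpace E] [MeasurableSingletonClass E] (μ : Measure α) {f : α → E}
    (hf : Measurable f) (s : Set α) : μ s = ∑ j, μ (s ∩ {x | f x = j}) := by
  have h := sum_measure_preimage_singleton (μ := μ.restrict s) Finset.univ (f := f)
    fun y _ => hf (measurableSet_singleton y)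
  simp only [Finset.coe_univ, Set.preimage_univ, Measure.restrict_apply_univ] at h
  rw [← h]
  refine Finset.sum_congr rfl fun j _ => ?_
  rw [Measure.restrict_apply (hf (measurableSet_singleton j)), Set.inter_comm]
  rfl

namespace MarkovAdditiveChain

section PathSpace

variable {E : Type*}

/-- The path seen from time `T` on, with the level recentred at its value at time `T`. -/
def recenter (T : ℕ) (w : ℕ → ℤ × E) : ℕ → ℤ × E :=
  fun n => ((w (T + n)).1 - (w T).1, (w (T + n)).2)

theorem recenter_recenter (S T : ℕ) (w : ℕ → ℤ × E) :
    recenter S (recenter T w) = recenter (T + S) w := by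
  funext n
  simp [recenter, add_assoc]

variable [MeasurableSpace E]

theorem measurable_recenter (T : ℕ) : Measurable (recenter (E := E) T) :=
  measurable_pi_lambda _ fun n =>
    ((measurable_pi_apply (T + n)).fst.sub (measurable_pi_apply T).fst).prodMk
      (measurable_pi_apply (T + n)).snd

/-- The history of the coordinate process up to time `T`. -/
@[reducible] def history (E : Type*) [MeasurableSpace E] (T : ℕ) : MeasurableSpace (ℕ → ℤ × E) :=
  ⨆ k ≤ T, MeasurableSpace.comap (fun w => w k) inferInstance

theorem history_mono : Monotone (history E) := fun _ _ h =>
  biSup_mono fun _ hk => hk.trans h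

theorem history_le (T : ℕ) : history E T ≤ MeasurableSpace.pi :=
  iSup₂_le fun k _ => (measurable_pi_apply k).comap_le

theorem iSup_history : ⨆ T, history E T = MeasurableSpace.pi := by
  refine le_antisymm (iSup_le history_le) ?_
  rw [MeasurableSpace.pi]
  exact iSup_le fun k => le_iSup_of_le k (le_iSup₂_of_le k le_rfl le_rfl)

end PathSpace

variable {Ω E : Type*} [MeasurableSpace Ω] [MeasurableSpace E] (M : MarkovAdditiveChain Ω E)

instance (x : ℤ) (i : E) : IsProbabilityMeasure (M.law x i) := M.isProbabilityMeasure_law x i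

/-- The path of the chain, with the level recentred at its initial value. -/
def path (ω : Ω) : ℕ → ℤ × E := fun n => (M.X n ω - M.X 0 ω, M.J n ω)

theorem measurable_path : Measurable M.path :=
  measurable_pi_lambda _ fun n =>
    ((M.measurable_X n).sub (M.measurable_X 0)).prodMk (M.measurable_J n)

/-- The law of the recentred path of the chain started from phase `i`. -/
noncomputable def pathLaw (i : E) : Measure (ℕ → ℤ × E) := (M.law 0 i).map M.path

instance (i : E) : IsProbabilityMeasure (M.pathLaw i) :=
  Measure.isProbabilityMeasure_map M.measurable_path.aemeasurable

theorem pathLaw_apply (i : E) {C : Set (ℕ → ℤ × E)} (hC : MeasurableSet C) :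
    M.pathLaw i C = M.law 0 i {ω | M.path ω ∈ C} := Measure.map_apply M.measurable_path hC

theorem measurable_history_path (T : ℕ) :
    Measurable[⨆ k ≤ T, MeasurableSpace.comap (fun ω => (M.X k ω, M.J k ω)) inferInstance,
      history E T] M.path := by
  rw [measurable_iff_comap_le, history, MeasurableSpace.comap_iSup]
  refine iSup_le fun k => ?_
  rw [MeasurableSpace.comap_iSup]
  refine iSup_le fun hk => ?_
  rw [MeasurableSpace.comap_comp, ← measurable_iff_comap_le]
  have h : ∀ l ≤ T, Measurable[⨆ k ≤ T, MeasurableSpace.comap (fun ω => (M.X k ω, M.J k ω))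
      inferInstance] fun ω => (M.X l ω, M.J l ω) := by
    intro l hl
    rw [measurable_iff_comap_le]
    exact le_iSup₂_of_le l hl le_rfl
  exact ((h k hk).fst.sub (h 0 (Nat.zero_le _)).fst).prodMk (h k hk).snd

/-- The Markov additive property at time 0 with trivial history already contains translation
invariance in the level. -/
theorem law_path (x : ℤ) (i : E) {C : Set (ℕ → ℤ × E)} (hC : MeasurableSet C) :
    M.law x i {ω | M.path ω ∈ C} = M.pathLaw i C := by
  have h := M.markov_additive x i 0 i Set.univ C MeasurableSet.univ hC
  have h0 : ∀ᵐ ω ∂M.law x i, ω ∈ {ω | M.J 0 ω = i} := (M.start x i).mono fun ω h => h.2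
  have h1 : M.law x i (Set.univ ∩ {ω | M.J 0 ω = i}) = 1 := by
    rw [Set.univ_inter, measure_eq_measure_of_null_sdiff (Set.subset_univ _) ?_, measure_univ]
    rw [← Set.compl_eq_univ_sdiff]
    exact h0
  rw [h1, one_mul] at h
  rw [pathLaw_apply _ _ hC]
  simp only [zero_add] at h
  refine Eq.trans ?_ h
  refine measure_congr ?_
  filter_upwards [h0] with ω hω
  refine propext ⟨fun h' => ⟨⟨trivial, hω⟩, h'⟩, fun h' => h'.2⟩

/-- A measurable null superset replaces measurability of `p`. -/
theorem ae_law_path (x : ℤ) (i : E) {p : (ℕ → ℤ × E) → Prop} (h : ∀ᵐ w ∂M.pathLaw i, p w) :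
    ∀ᵐ ω ∂M.law x i, p (M.path ω) := by
  rw [ae_iff] at h ⊢
  obtain ⟨t, ht, htm, ht0⟩ := exists_measurable_superset_of_null h
  refine measure_mono_null (t := {ω | M.path ω ∈ t}) (fun ω hω => ht hω) ?_
  rw [M.law_path x i htm, ht0]

theorem P_nonneg (i j : E) : 0 ≤ M.P i j := measureReal_nonneg

/-- The law of the recentred path, started from the phase distribution `π`. -/
noncomputable def mixedLaw [Fintype E] (π : E → ℝ) : Measure (ℕ → ℤ × E) :=
  ∑ i, ENNReal.ofReal (π i) • M.pathLaw i

theorem mixedLaw_apply [Fintype E] (π : E → ℝ) (C : Set (ℕ → ℤ × E)) :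
    M.mixedLaw π C = ∑ i, ENNReal.ofReal (π i) * M.pathLaw i C := by
  simp [mixedLaw]

variable [MeasurableSingletonClass E]

theorem ae_pathLaw_start (i : E) : ∀ᵐ w ∂M.pathLaw i, (w 0).1 = 0 ∧ (w 0).2 = i := by
  rw [pathLaw, ae_map_iff M.measurable_path.aemeasurable]
  · filter_upwards [M.start 0 i] with ω hω
    exact ⟨sub_self _, hω.2⟩
  · exact ((measurable_pi_apply 0).fst (measurableSet_singleton 0)).inter
      ((measurable_pi_apply 0).snd (measurableSet_singleton i))

/-- The Markov additive property on the path space. -/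
theorem pathLaw_markov (i : E) (T : ℕ) (j : E) {B C : Set (ℕ → ℤ × E)}
    (hB : MeasurableSet[history E T] B) (hC : MeasurableSet C) :
    M.pathLaw i (B ∩ {w | (w T).2 = j} ∩ recenter T ⁻¹' C) =
      M.pathLaw i (B ∩ {w | (w T).2 = j}) * M.pathLaw j C := by
  have hJ : MeasurableSet {w : ℕ → ℤ × E | (w T).2 = j} :=
    (measurable_pi_apply T).snd (measurableSet_singleton j)
  have hBJ := (history_le T B hB).inter hJ
  rw [M.pathLaw_apply i (hBJ.inter (measurable_recenter T hC)), M.pathLaw_apply i hBJ,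
    M.pathLaw_apply j hC]
  have h := M.markov_additive 0 i T j _ C (M.measurable_history_path T hB) hC
  refine Eq.trans ?_ h
  have e : ∀ ω, recenter T (M.path ω) = fun n => (M.X (T + n) ω - M.X T ω, M.J (T + n) ω) :=
    fun ω => funext fun n => by simp [recenter, path]
  congr 1
  ext ω
  simp only [Set.mem_inter_iff, Set.mem_preimage, Set.mem_ofPred_eq, e]
  rfl

/-! ### Stationarity, zero-one law and ergodicity of the shift -/

section Stationary

variable [Fintype E]

omit [Fintype E] in
theorem P_apply (i j : E) : M.P i j = (M.pathLaw i).real {w | (w 1).2 = j} := by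
  have h : MeasurableSet {w : ℕ → ℤ × E | (w 1).2 = j} :=
    (measurable_pi_apply 1).snd (measurableSet_singleton j)
  rw [measureReal_def, M.pathLaw_apply i h]
  rfl

omit [Fintype E] in
theorem ofReal_P (i j : E) : ENNReal.ofReal (M.P i j) = M.pathLaw i {w | (w 1).2 = j} := by
  rw [P_apply, ofReal_measureReal]

theorem pathLaw_recenter (i : E) (T : ℕ) {C : Set (ℕ → ℤ × E)} (hC : MeasurableSet C) :
    M.pathLaw i (recenter T ⁻¹' C) = ∑ j, M.pathLaw i {w | (w T).2 = j} * M.pathLaw j C := by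
  rw [measure_eq_sum_inter_preimage_singleton (M.pathLaw i) (measurable_pi_apply T).snd]
  refine Finset.sum_congr rfl fun j _ => ?_
  have h := M.pathLaw_markov i T j (B := Set.univ) MeasurableSet.univ hC
  rw [Set.univ_inter, Set.inter_comm] at h
  exact h

theorem sum_P (i : E) : ∑ j, M.P i j = 1 := by
  have h := M.pathLaw_recenter i 1 (C := Set.univ) MeasurableSet.univ
  simp only [Set.preimage_univ, measure_univ, mul_one, ← ofReal_P] at h
  rw [← ENNReal.ofReal_sum_of_nonneg fun j _ => M.P_nonneg i j] at h
  exact (ENNReal.ofReal_eq_one.1 h.symm)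

variable {M} {π : E → ℝ}

omit [MeasurableSingletonClass E] in
theorem isProbabilityMeasure_mixedLaw (hπ : IsStationaryDistribution M.P π) :
    IsProbabilityMeasure (M.mixedLaw π) := by
  constructor
  simp only [mixedLaw_apply, measure_univ, mul_one]
  rw [← ENNReal.ofReal_sum_of_nonneg fun i _ => hπ.nonneg i, hπ.sum_eq_one, ENNReal.ofReal_one]

theorem measurePreserving_recenter (hπ : IsStationaryDistribution M.P π) :
    MeasurePreserving (recenter 1) (M.mixedLaw π) (M.mixedLaw π) := by
  refine ⟨measurable_recenter 1, Measure.ext fun C hC => ?_⟩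
  rw [Measure.map_apply (measurable_recenter 1) hC, mixedLaw_apply, mixedLaw_apply]
  simp only [M.pathLaw_recenter _ 1 hC, ← ofReal_P, Finset.mul_sum]
  rw [Finset.sum_comm]
  refine Finset.sum_congr rfl fun j _ => ?_
  simp only [← mul_assoc]
  rw [← Finset.sum_mul]
  congr 1
  simp only [← ENNReal.ofReal_mul (hπ.nonneg _)]
  rw [← ENNReal.ofReal_sum_of_nonneg fun i _ => mul_nonneg (hπ.nonneg i) (M.P_nonneg i j)]
  congr 1
  exact congrFun hπ.stationary j

/-- Shift invariant events have the same probability from every starting phase. -/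
theorem pathLaw_eq_of_invariant (hirr : M.P.IsIrreducible) {C : Set (ℕ → ℤ × E)}
    (hC : MeasurableSet C) (hinv : recenter 1 ⁻¹' C = C) (i j : E) :
    M.pathLaw i C = M.pathLaw j C := by
  have h := hirr.eq_of_le_mulVec M.sum_P (u := fun i => (M.pathLaw i).real C) (fun i => ?_) i j
  · exact (measureReal_eq_measureReal_iff).1 h
  · have h1 := M.pathLaw_recenter i 1 hC
    rw [hinv] at h1
    rw [measureReal_def, h1, ENNReal.toReal_sum fun j _ => by finiteness]
    refine Finset.sum_le_sum fun j _ => ?_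
    rw [ENNReal.toReal_mul, P_apply]
    rfl

/-- The zero-one law for shift invariant events. -/
theorem pathLaw_eq_zero_or_one (hirr : M.P.IsIrreducible) {C : Set (ℕ → ℤ × E)}
    (hC : MeasurableSet C) (hinv : recenter 1 ⁻¹' C = C) (i : E) :
    M.pathLaw i C = 0 ∨ M.pathLaw i C = 1 := by
  have hinvT : ∀ T, 0 < T → recenter T ⁻¹' C = C := by
    intro T hT
    induction T, hT using Nat.le_induction with
    | base => exact hinv
    | succ T hT ih =>
      nth_rw 2 [← ih]
      nth_rw 2 [← hinv]
      ext w
      simp only [Set.mem_preimage, recenter_recenter]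
  -- Being invariant, `C` is an event about the recentred future, whose conditional probability is
  -- the same for every phase reached at time `T + 1`.
  have hind : ∀ T, ProbabilityTheory.Indep (history E (T + 1)) (MeasurableSpace.generateFrom {C})
      (M.pathLaw i) := by
    intro T
    refine ProbabilityTheory.IndepSets.indep (history_le _)
      (MeasurableSpace.generateFrom_le fun t ht => by rwa [Set.mem_singleton_iff.1 ht])
      (@MeasurableSpace.isPiSystem_measurableSet _ (history E (T + 1))) (IsPiSystem.singleton C)
      (@MeasurableSpace.generateFrom_measurableSet _ (history E (T + 1))).symm rfl ?_
    rw [ProbabilityTheory.IndepSets_iff]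
    rintro A D hA hD
    rw [Set.mem_singleton_iff.1 hD,
      measure_eq_sum_inter_preimage_singleton (M.pathLaw i) (measurable_pi_apply (T + 1)).snd
        (A ∩ C), measure_eq_sum_inter_preimage_singleton (M.pathLaw i)
        (measurable_pi_apply (T + 1)).snd A, Finset.sum_mul]
    refine Finset.sum_congr rfl fun j _ => ?_
    rw [pathLaw_eq_of_invariant hirr hC hinv i j, ← M.pathLaw_markov i (T + 1) j hA hC,
      hinvT _ T.succ_pos, Set.inter_right_comm]
  have h := ProbabilityTheory.indep_iSup_of_monotone hind (fun T => history_le _)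
    (MeasurableSpace.generateFrom_le fun t ht => by rwa [Set.mem_singleton_iff.1 ht])
    (fun S T hST => history_mono (Nat.succ_le_succ hST))
  rw [Monotone.iSup_nat_add history_mono 1, iSup_history] at h
  refine ProbabilityTheory.measure_eq_zero_or_one_of_indepSet_self ?_
  rw [ProbabilityTheory.IndepSet_iff_Indep]
  exact ProbabilityTheory.indep_of_indep_of_le_left h
    (MeasurableSpace.generateFrom_le fun t ht => by rwa [Set.mem_singleton_iff.1 ht])

theorem ergodic_recenter (hirr : M.P.IsIrreducible) (hπ : IsStationaryDistribution M.P π) :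
    Ergodic (recenter 1) (M.mixedLaw π) := by
  have := isProbabilityMeasure_mixedLaw hπ
  refine ⟨measurePreserving_recenter hπ, ⟨fun {C} hC hinv => ?_⟩⟩
  have : Nonempty E := by
    by_contra hcon
    rw [not_nonempty_iff] at hcon
    simpa using hπ.sum_eq_one
  have i : E := Classical.arbitrary E
  have hm : M.mixedLaw π C = M.pathLaw i C := by
    rw [mixedLaw_apply]
    simp only [fun j => pathLaw_eq_of_invariant hirr hC hinv j i]
    rw [← Finset.sum_mul, ← ENNReal.ofReal_sum_of_nonneg fun i _ => hπ.nonneg i,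
      hπ.sum_eq_one, ENNReal.ofReal_one, one_mul]
  rw [eventuallyConst_set']
  rcases pathLaw_eq_zero_or_one hirr hC hinv i with h | h
  · left
    rw [ae_eq_empty, hm, h]
  · right
    rw [ae_eq_univ_iff_measure_eq hC.nullMeasurableSet, hm, h, measure_univ]

omit [MeasurableSingletonClass E] in
theorem ae_pathLaw_of_ae_mixedLaw (hirr : M.P.IsIrreducible)
    (hπ : IsStationaryDistribution M.P π) {p : (ℕ → ℤ × E) → Prop}
    (h : ∀ᵐ w ∂M.mixedLaw π, p w) (i : E) : ∀ᵐ w ∂M.pathLaw i, p w := by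
  rw [ae_iff, mixedLaw_apply, Finset.sum_eq_zero_iff] at h
  exact (mul_eq_zero.1 (h i (Finset.mem_univ i))).resolve_left
    (ENNReal.ofReal_pos.2 (hπ.pos hirr i)).ne'

omit [MeasurableSingletonClass E] in
theorem ae_mixedLaw_of_ae_pathLaw {p : (ℕ → ℤ × E) → Prop}
    (h : ∀ i, ∀ᵐ w ∂M.pathLaw i, p w) : ∀ᵐ w ∂M.mixedLaw π, p w := by
  rw [ae_iff, mixedLaw_apply, Finset.sum_eq_zero_iff]
  exact fun i _ => mul_eq_zero_of_right _ (h i)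

end Stationary

end MarkovAdditiveChain

/-! ### Birkhoff's theorem with mean minus infinity -/

section ExtendedErgodicTheorem

variable {α : Type*} {θ : α → α} {f : α → ℝ} [MeasurableSpace α] {μ : Measure α}

theorem integrable_of_lintegral_ofReal_ne_top (hf : Measurable f)
    (hU : ∫⁻ x, ENNReal.ofReal (f x) ∂μ ≠ ⊤) (hD : ∫⁻ x, ENNReal.ofReal (-f x) ∂μ ≠ ⊤) :
    Integrable f μ := by
  refine ⟨hf.aestronglyMeasurable, ?_⟩
  rw [hasFiniteIntegral_iff_norm]
  refine lt_of_le_of_lt (lintegral_mono (g := fun x => ENNReal.ofReal (f x) +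
    ENNReal.ofReal (-f x)) fun x => ?_) ?_
  · rcases le_total 0 (f x) with h | h
    · rw [Real.norm_of_nonneg h]; exact le_self_add
    · rw [Real.norm_of_nonpos h]; exact le_add_self
  · rw [lintegral_add_left hf.ennreal_ofReal]
    exact ENNReal.add_lt_top.2 ⟨hU.lt_top, hD.lt_top⟩

theorem extExpectation_eq_integral (hi : Integrable f μ) :
    extExpectation μ f = ((∫ x, f x ∂μ : ℝ) : EReal) := by
  have h1 : ∫⁻ x, ENNReal.ofReal (f x) ∂μ ≠ ⊤ := hi.lintegral_lt_top.ne
  have h2 : ∫⁻ x, ENNReal.ofReal (-f x) ∂μ ≠ ⊤ := hi.neg.lintegral_lt_top.ne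
  rw [integral_eq_lintegral_pos_part_sub_lintegral_neg_part hi, extExpectation, EReal.coe_sub,
    EReal.coe_ennreal_toReal h1, EReal.coe_ennreal_toReal h2]

/-- Truncation at `-K` leaves the positive part unchanged, while the integrals of the negative parts
increase to infinity by monotone convergence. -/
theorem exists_integral_max_neg_lt [IsFiniteMeasure μ] (hf : Measurable f)
    (hU : ∫⁻ x, ENNReal.ofReal (f x) ∂μ ≠ ⊤) (hD : ∫⁻ x, ENNReal.ofReal (-f x) ∂μ = ⊤) (a : ℝ) :
    ∃ K : ℕ, Integrable (fun x => max (f x) (-K)) μ ∧ ∫ x, max (f x) (-K) ∂μ < a := by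
  have hUK : ∀ K : ℕ, ∫⁻ x, ENNReal.ofReal (max (f x) (-K)) ∂μ =
      ∫⁻ x, ENNReal.ofReal (f x) ∂μ := by
    intro K
    refine lintegral_congr fun x => ?_
    rw [ENNReal.ofReal_max, max_eq_left]
    rw [ENNReal.ofReal_of_nonpos (by simp)]
    exact zero_le
  have hDK : ∀ K : ℕ, ∫⁻ x, ENNReal.ofReal (-max (f x) (-K)) ∂μ ≠ ⊤ := by
    intro K
    refine ((lintegral_mono (g := fun _ => ENNReal.ofReal K) fun x => ?_).trans_lt ?_).ne
    · exact ENNReal.ofReal_le_ofReal (by linarith [le_max_right (f x) (-(K : ℝ))])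
    · rw [lintegral_const]; finiteness
  have hm : ∀ K : ℕ, Measurable fun x => max (f x) (-(K : ℝ)) := fun K => hf.max measurable_const
  have hI : ∀ K : ℕ, Integrable (fun x => max (f x) (-(K : ℝ))) μ := fun K =>
    integrable_of_lintegral_ofReal_ne_top (hm K) (by rw [hUK]; exact hU) (hDK K)
  have hlim : Tendsto (fun K : ℕ => ∫⁻ x, ENNReal.ofReal (-max (f x) (-K)) ∂μ) atTop (𝓝 ⊤) := by
    rw [← hD]
    refine lintegral_tendsto_of_tendsto_of_monotone
      (fun K => ((hm K).neg.ennreal_ofReal).aemeasurable) (ae_of_all _ fun x => ?_)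
      (ae_of_all _ fun x => ?_)
    · intro K L hKL
      refine ENNReal.ofReal_le_ofReal (neg_le_neg (max_le_max le_rfl (neg_le_neg ?_)))
      exact_mod_cast hKL
    · obtain ⟨K, hK⟩ := exists_nat_ge (-f x)
      refine tendsto_const_nhds.congr' ?_
      filter_upwards [eventually_ge_atTop K] with L hL
      have : (K : ℝ) ≤ L := by exact_mod_cast hL
      rw [max_eq_left (by linarith)]
  set U := (∫⁻ x, ENNReal.ofReal (f x) ∂μ).toReal
  obtain ⟨K, hK⟩ := (hlim.eventually (lt_mem_nhds (ENNReal.ofReal_lt_top (r := U - a)))).exists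
  refine ⟨K, hI K, ?_⟩
  rw [integral_eq_lintegral_pos_part_sub_lintegral_neg_part (hI K), hUK]
  rw [← ENNReal.ofReal_toReal (hDK K)] at hK
  have := (ENNReal.ofReal_lt_ofReal_iff'.1 hK).1
  linarith

/-- Birkhoff's ergodic theorem for functions whose negative part need not be integrable. -/
theorem Ergodic.ae_tendsto_birkhoffSum_div_extExpectation [IsProbabilityMeasure μ]
    (hθ : Ergodic θ μ) (hf : Measurable f) (hU : ∫⁻ x, ENNReal.ofReal (f x) ∂μ ≠ ⊤) :
    ∀ᵐ x ∂μ, Tendsto (fun n : ℕ => ((birkhoffSum θ f n x / n : ℝ) : EReal)) atTop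
      (𝓝 (extExpectation μ f)) := by
  by_cases hD : ∫⁻ x, ENNReal.ofReal (-f x) ∂μ = ⊤
  · have hbot : extExpectation μ f = ⊥ := by
      rw [extExpectation, hD]
      simp
    rw [hbot]
    have key : ∀ a : ℤ, ∀ᵐ x ∂μ, ∀ᶠ n : ℕ in atTop, birkhoffSum θ f n x / n < a := by
      intro a
      obtain ⟨K, hI, hK⟩ := exists_integral_max_neg_lt hf hU hD a
      filter_upwards [hθ.ae_tendsto_birkhoffSum_div (hf.max measurable_const) hI] with x hx
      filter_upwards [hx.eventually (gt_mem_nhds hK)] with n hn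
      refine lt_of_le_of_lt ?_ hn
      gcongr
      exact Finset.sum_le_sum fun k _ => le_max_left _ _
    filter_upwards [ae_all_iff.2 key] with x hx
    rw [EReal.tendsto_nhds_bot_iff_real]
    intro a
    obtain ⟨b, hb⟩ := exists_int_lt a
    filter_upwards [hx b] with n hn
    exact_mod_cast hn.trans hb
  · have hi := integrable_of_lintegral_ofReal_ne_top hf hU hD
    filter_upwards [hθ.ae_tendsto_birkhoffSum_div hf hi] with x hx
    rw [extExpectation_eq_integral hi]
    exact EReal.tendsto_coe.2 hx

end ExtendedErgodicTheorem

/-! ### Integer sequences: future minima and finite lower limits -/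

section IntegerSequences

/-- By integrality, each strict future minimum raises the floor under all later values by at least
one. -/
theorem add_card_futureMin_le {x : ℕ → ℤ} {L : ℤ} (hL : ∀ n, L ≤ x n)
    [DecidablePred fun k => ∀ m, k < m → x k < x m] (N : ℕ) :
    ∀ m ≥ N, L + ((Finset.range N).filter fun k => ∀ m, k < m → x k < x m).card ≤ x m := by
  induction N with
  | zero => intro m _; simpa using hL m
  | succ N ih =>
    intro m hm
    rw [Finset.range_add_one, Finset.filter_insert]
    split_ifs with h
    · rw [Finset.card_insert_of_notMem (by simp)]
      have h1 := ih N le_rfl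
      have h2 := h m hm
      push_cast
      linarith
    · exact ih m (by omega)

/-- Iterating `h` from time 0 produces arbitrarily late values not above `x 0`. -/
theorem not_tendsto_atTop_of_forall_exists_le {x : ℕ → ℤ} (h : ∀ k, ∃ m > k, x m ≤ x k) :
    ¬ Tendsto x atTop atTop := by
  intro hx
  have h1 : ∀ N, ∃ n ≥ N, x n ≤ x 0 := by
    intro N
    induction N with
    | zero => exact ⟨0, le_rfl, le_rfl⟩
    | succ N ih =>
      obtain ⟨n, hn, hx⟩ := ih
      obtain ⟨m, hm, hxm⟩ := h n
      exact ⟨m, by omega, hxm.trans hx⟩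
  obtain ⟨N, hN⟩ := eventually_atTop.1 (hx.eventually (eventually_gt_atTop (x 0)))
  obtain ⟨n, hn, hle⟩ := h1 N
  exact absurd (hN n hn) (not_lt.2 hle)

/-- Otherwise `L` is an eventual lower bound; as the sequence does not tend to infinity, there is a
greatest one. By integrality it is attained infinitely often, which `h2` excludes. -/
theorem frequently_lt_of_not_tendsto {x : ℕ → ℤ} (h1 : ¬ Tendsto x atTop atTop)
    (h2 : ∀ z, ¬ ((∃ᶠ n in atTop, x n = z) ∧ ∀ᶠ n in atTop, z ≤ x n)) (L : ℤ) :
    ∃ᶠ n in atTop, x n < L := by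
  by_contra hcon
  simp only [not_frequently, not_lt] at hcon
  rw [tendsto_atTop] at h1
  push Not at h1
  obtain ⟨B, hB⟩ := h1
  obtain ⟨z, hz, hmax⟩ := Int.exists_greatest_of_bdd (P := fun z => ∀ᶠ n in atTop, z ≤ x n)
    ⟨B, fun z hz => by
      by_contra! hlt
      exact hB (hz.mono fun n hn => not_lt.2 (hlt.le.trans hn))⟩ ⟨L, hcon⟩
  refine h2 z ⟨?_, hz⟩
  have h3 : ∃ᶠ n in atTop, ¬ (z + 1 ≤ x n) := by
    intro h4
    simp only [not_not] at h4
    have := hmax _ h4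
    omega
  exact (h3.and_eventually hz).mono fun n hn => by omega

theorem liminf_intCast_eq_bot {x : ℕ → ℤ} (h : ∀ L, ∃ᶠ n in atTop, x n < L) :
    liminf (fun n => ((x n : ℝ) : EReal)) atTop = ⊥ := by
  rw [EReal.eq_bot_iff_forall_lt]
  intro y
  obtain ⟨L, hL⟩ := exists_int_lt y
  refine lt_of_le_of_lt (liminf_le_of_frequently_le' (x := ((L : ℝ) : EReal)) ?_)
    (by exact_mod_cast hL)
  exact (h L).mono fun n hn => by exact_mod_cast hn.le

theorem limsup_intCast_eq_top {x : ℕ → ℤ} (h : ∀ L, ∃ᶠ n in atTop, L < x n) :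
    limsup (fun n => ((x n : ℝ) : EReal)) atTop = ⊤ := by
  rw [EReal.eq_top_iff_forall_lt]
  intro y
  obtain ⟨L, hL⟩ := exists_int_gt y
  refine lt_of_lt_of_le (b := ((L : ℝ) : EReal)) (by exact_mod_cast hL)
    (le_limsup_of_frequently_le' ?_)
  exact (h L).mono fun n hn => by exact_mod_cast hn.le

end IntegerSequences

/-! ### Law of large numbers on path space; no divergence at zero drift -/

namespace MarkovAdditiveChain

section Recenter

variable {E : Type*}

theorem recenter_one_iterate_sub (k m l : ℕ) (w : ℕ → ℤ × E) :
    ((recenter 1)^[k] w m).1 - ((recenter 1)^[k] w l).1 = (w (k + m)).1 - (w (k + l)).1 := by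
  induction k generalizing m l with
  | zero => simp
  | succ k ih =>
    rw [Function.iterate_succ_apply']
    have := ih (1 + m) (1 + l)
    simp only [recenter, sub_sub_sub_cancel_right]
    rw [this, show k + 1 + m = k + (1 + m) by ring, show k + 1 + l = k + (1 + l) by ring]

theorem birkhoffSum_recenter_increment (n : ℕ) (w : ℕ → ℤ × E) :
    birkhoffSum (recenter 1) (fun w => (((w 1).1 - (w 0).1 : ℤ) : ℝ)) n w =
      (((w n).1 - (w 0).1 : ℤ) : ℝ) := by
  simp only [birkhoffSum, recenter_one_iterate_sub, add_zero]
  rw [← Int.cast_sum]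
  exact congrArg _ (Finset.sum_range_sub (fun k => (w k).1) n)

/-- The paths whose level, times `σ`, exceeds its initial value at all later times. -/
def staysAbove (E : Type*) (σ : ℤ) : Set (ℕ → ℤ × E) :=
  {w | ∀ m, 0 < m → σ * (w 0).1 < σ * (w m).1}

theorem recenter_one_iterate_mem_staysAbove {σ : ℤ} (k : ℕ) (w : ℕ → ℤ × E) :
    (recenter 1)^[k] w ∈ staysAbove E σ ↔ ∀ m, k < m → σ * (w k).1 < σ * (w m).1 := by
  have h : ∀ m, σ * ((recenter 1)^[k] w 0).1 < σ * ((recenter 1)^[k] w m).1 ↔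
      σ * (w k).1 < σ * (w (k + m)).1 := by
    intro m
    rw [← sub_pos, ← mul_sub, recenter_one_iterate_sub, mul_sub, sub_pos, add_zero]
  refine ⟨fun hw m hm => ?_, fun hw m hm => (h m).2 (hw _ (by omega))⟩
  have := (h (m - k)).1 (hw (m - k) (by omega))
  rwa [Nat.add_sub_cancel' hm.le] at this

/-- The paths whose extreme limit of the level, in the direction `-σ`, is the value `z`. -/
def extremeLimit (E : Type*) (σ z : ℤ) : Set (ℕ → ℤ × E) :=
  {w | (∃ᶠ n in atTop, (w n).1 = z) ∧ ∀ᶠ n in atTop, σ * z ≤ σ * (w n).1}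

theorem recenter_one_mem_extremeLimit {σ z : ℤ} (w : ℕ → ℤ × E) :
    recenter 1 w ∈ extremeLimit E σ z ↔ w ∈ extremeLimit E σ (z + (w 1).1) := by
  refine and_congr ?_ ?_
  · conv_rhs => rw [← map_add_atTop_eq_nat 1]
    rw [frequently_map]
    refine Iff.of_eq (congrArg (fun p => Filter.Frequently p atTop) (funext fun n => ?_))
    rw [recenter, add_comm 1 n]
    exact propext sub_eq_iff_eq_add
  · conv_rhs => rw [← map_add_atTop_eq_nat 1]
    rw [eventually_map]
    refine Iff.of_eq (congrArg (fun p => Filter.Eventually p atTop) (funext fun n => ?_))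
    rw [recenter, add_comm 1 n]
    simp only [mul_sub, mul_add, eq_iff_iff]
    constructor <;> intro h <;> linarith

theorem eq_of_mem_extremeLimit {σ y z : ℤ} (hσ : σ ≠ 0) {w : ℕ → ℤ × E}
    (hy : w ∈ extremeLimit E σ y) (hz : w ∈ extremeLimit E σ z) : y = z := by
  obtain ⟨n, hn, hn'⟩ := (hy.1.and_eventually hz.2).exists
  obtain ⟨m, hm, hm'⟩ := (hz.1.and_eventually hy.2).exists
  rw [hn] at hn'
  rw [hm] at hm'
  exact mul_left_cancel₀ hσ (le_antisymm hm' hn')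

variable [MeasurableSpace E]

theorem measurable_level (n : ℕ) : Measurable fun w : ℕ → ℤ × E => (w n).1 :=
  (measurable_pi_apply n).fst

theorem measurableSet_staysAbove (σ : ℤ) : MeasurableSet (staysAbove E σ) := by
  rw [staysAbove, Set.ofPred_forall]
  refine MeasurableSet.iInter fun m => ?_
  rw [Set.ofPred_forall]
  exact MeasurableSet.iInter fun _ => measurableSet_lt ((measurable_level 0).const_mul σ)
    ((measurable_level m).const_mul σ)

theorem measurableSet_extremeLimit (σ z : ℤ) : MeasurableSet (extremeLimit E σ z) := by
  have h : extremeLimit E σ z = limsup (fun n => {w | (w n).1 = z}) atTop ∩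
      liminf (fun n => {w | σ * z ≤ σ * (w n).1}) atTop := by
    ext w
    simp only [Set.mem_inter_iff, mem_limsup_iff_frequently_mem,
      mem_liminf_iff_eventually_mem]
    rfl
  rw [h]
  refine (MeasurableSet.measurableSet_limsup fun n => ?_).inter
    (MeasurableSet.measurableSet_liminf fun n => ?_)
  · exact measurable_level n (measurableSet_singleton z)
  · exact measurableSet_le measurable_const ((measurable_level n).const_mul σ)

end Recenter

variable {Ω E : Type*} [MeasurableSpace Ω] [MeasurableSpace E] {M : MarkovAdditiveChain Ω E}
  [MeasurableSingletonClass E] [Fintype E] {π : E → ℝ}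

theorem ae_mixedLaw_start : ∀ᵐ w ∂M.mixedLaw π, (w 0).1 = 0 :=
  ae_mixedLaw_of_ae_pathLaw fun i => (M.ae_pathLaw_start i).mono fun _ h => h.1

/-- The strong law of large numbers for the level. -/
theorem ae_tendsto_level_div (hirr : M.P.IsIrreducible) (hπ : IsStationaryDistribution M.P π)
    (hU : ∫⁻ w, ENNReal.ofReal ((w 1).1 : ℝ) ∂M.mixedLaw π ≠ ⊤) :
    ∀ᵐ w ∂M.mixedLaw π, Tendsto (fun n : ℕ => ((((w n).1 : ℝ) / n : ℝ) : EReal)) atTop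
      (𝓝 (extExpectation (M.mixedLaw π) fun w => ((w 1).1 : ℝ))) := by
  have := isProbabilityMeasure_mixedLaw hπ
  -- The Birkhoff sums of the increment telescope on every path; it agrees with the level at time 1
  -- almost surely, as paths start at level 0.
  set f : (ℕ → ℤ × E) → ℝ := fun w => (((w 1).1 - (w 0).1 : ℤ) : ℝ) with hf
  have hfm : Measurable f :=
    measurable_from_top.comp ((measurable_level 1).sub (measurable_level 0))
  have h0 : ∀ᵐ w ∂M.mixedLaw π, f w = ((w 1).1 : ℝ) :=
    (ae_mixedLaw_start (M := M)).mono fun w hw => by simp [hf, hw]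
  have e1 : ∫⁻ w, ENNReal.ofReal (f w) ∂M.mixedLaw π =
      ∫⁻ w, ENNReal.ofReal ((w 1).1 : ℝ) ∂M.mixedLaw π :=
    lintegral_congr_ae (h0.mono fun w hw => by simp only [hw])
  have e2 : ∫⁻ w, ENNReal.ofReal (-f w) ∂M.mixedLaw π =
      ∫⁻ w, ENNReal.ofReal (-((w 1).1 : ℝ)) ∂M.mixedLaw π :=
    lintegral_congr_ae (h0.mono fun w hw => by simp only [hw])
  have e3 : extExpectation (M.mixedLaw π) (fun w => ((w 1).1 : ℝ)) =
      extExpectation (M.mixedLaw π) f := by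
    rw [extExpectation, extExpectation, e1, e2]
  rw [e3]
  filter_upwards [(ergodic_recenter hirr hπ).ae_tendsto_birkhoffSum_div_extExpectation hfm
    (e1 ▸ hU), ae_mixedLaw_start (M := M)] with w hw hw0
  refine hw.congr fun n => ?_
  rw [birkhoffSum_recenter_increment, hw0, sub_zero]

/-- If the level grows sublinearly, then almost no path stays above its initial level. -/
theorem mixedLaw_staysAbove_eq_zero (hirr : M.P.IsIrreducible)
    (hπ : IsStationaryDistribution M.P π)
    (h : ∀ᵐ w ∂M.mixedLaw π, Tendsto (fun n : ℕ => ((w n).1 : ℝ) / n) atTop (𝓝 0)) (σ : ℤ) :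
    M.mixedLaw π (staysAbove E σ) = 0 := by
  classical
  have := isProbabilityMeasure_mixedLaw hπ
  have hm := measurableSet_staysAbove (E := E) σ
  have hB := (ergodic_recenter hirr hπ).ae_tendsto_birkhoffSum_div
    (measurable_const.indicator hm) ((integrable_const (1 : ℝ)).indicator hm)
  rw [integral_indicator_const _ hm, smul_eq_mul, mul_one] at hB
  by_contra hne
  -- One path suffices. Along `w` the future minima of the level times `σ` have density equal to the
  -- probability in question. Since `w` never goes below its start, counting them bounds this
  -- density by the limit of `σ * w n / n`, which is 0.
  obtain ⟨w, hwA, hw1, hw2⟩ : ∃ w ∈ staysAbove E σ,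
      Tendsto (fun n : ℕ => ((w n).1 : ℝ) / n) atTop (𝓝 0) ∧ Tendsto (fun n : ℕ =>
        birkhoffSum (recenter 1) ((staysAbove E σ).indicator fun _ => (1 : ℝ)) n w / n) atTop
        (𝓝 ((M.mixedLaw π).real (staysAbove E σ))) := by
    by_contra! hcon
    refine hne (measure_mono_null (fun w hw => ?_) (ae_iff.1 (h.and hB)))
    exact fun h => hcon w hw h.1 h.2
  have hsum : ∀ n, birkhoffSum (recenter 1) ((staysAbove E σ).indicator fun _ => (1 : ℝ)) n w =
      (((Finset.range n).filter fun k => ∀ m, k < m → σ * (w k).1 < σ * (w m).1).card : ℝ) := by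
    intro n
    rw [birkhoffSum, Finset.card_filter, Nat.cast_sum]
    refine Finset.sum_congr rfl fun k _ => ?_
    rw [Set.indicator_apply]
    simp only [recenter_one_iterate_mem_staysAbove]
    split_ifs <;> simp
  have hbd : ∀ n, σ * (w 0).1 ≤ σ * (w n).1 := fun n => by
    rcases Nat.eq_zero_or_pos n with rfl | hn
    · exact le_rfl
    · exact (hwA n hn).le
  have hle : ∀ n : ℕ, birkhoffSum (recenter 1) ((staysAbove E σ).indicator fun _ => (1 : ℝ)) n w
      / n ≤ σ * (((w n).1 : ℝ) / n) - (σ * (w 0).1 : ℝ) / n := by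
    intro n
    rw [hsum, ← mul_div_assoc, ← sub_div]
    have := add_card_futureMin_le hbd n n le_rfl
    gcongr
    have : (((σ * (w 0).1 + ((Finset.range n).filter fun k =>
      ∀ m, k < m → σ * (w k).1 < σ * (w m).1).card : ℤ)) : ℝ) ≤ ((σ * (w n).1 : ℤ) : ℝ) := by
      exact_mod_cast this
    push_cast at this
    linarith
  have hlim : Tendsto (fun n : ℕ => σ * (((w n).1 : ℝ) / n) - (σ * (w 0).1 : ℝ) / n) atTop
      (𝓝 0) := by
    simpa using (hw1.const_mul (σ : ℝ)).sub
      ((tendsto_const_nhds (x := (σ * (w 0).1 : ℝ))).div_atTop tendsto_natCast_atTop_atTop)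
  have hp := le_of_tendsto_of_tendsto' hw2 hlim hle
  exact hne ((measureReal_eq_zero_iff).1 (le_antisymm hp measureReal_nonneg))

/-- By invariance of the law, almost surely no shifted path stays above its start, so every time is
followed by one with a value no larger. -/
theorem ae_not_tendsto_of_sublinear (hirr : M.P.IsIrreducible)
    (hπ : IsStationaryDistribution M.P π)
    (h : ∀ᵐ w ∂M.mixedLaw π, Tendsto (fun n : ℕ => ((w n).1 : ℝ) / n) atTop (𝓝 0)) (σ : ℤ) :
    ∀ᵐ w ∂M.mixedLaw π, ¬ Tendsto (fun n => σ * (w n).1) atTop atTop := by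
  have h0 := mixedLaw_staysAbove_eq_zero hirr hπ h σ
  have h1 : ∀ᵐ w ∂M.mixedLaw π, ∀ k, (recenter 1)^[k] w ∉ staysAbove E σ := by
    rw [ae_all_iff]
    intro k
    exact ((measurePreserving_recenter hπ).iterate k).quasiMeasurePreserving.ae
      (measure_eq_zero_iff_ae_notMem.1 h0)
  filter_upwards [h1] with w hw
  refine not_tendsto_atTop_of_forall_exists_le fun k => ?_
  have := hw k
  rw [recenter_one_iterate_mem_staysAbove] at this
  push Not at this
  exact this

end MarkovAdditiveChain

/-! ### Finite extreme limits force degeneracy -/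

namespace MarkovAdditiveChain

variable {Ω E : Type*} [MeasurableSpace Ω] [MeasurableSpace E] {M : MarkovAdditiveChain Ω E}
  [MeasurableSingletonClass E] [Fintype E] {π : E → ℝ}

omit [Fintype E] in
theorem measurableSet_eq_step (p : ℤ × E) : MeasurableSet {w : ℕ → ℤ × E | w 1 = p} := by
  have h : Measurable fun w : ℕ → ℤ × E => w 1 := measurable_pi_apply 1
  exact h (measurableSet_singleton p)

variable (M) in
theorem tsum_pathLaw_step (i : E) (B : Set (ℕ → ℤ × E)) :
    M.pathLaw i B = ∑' p : ℤ × E, M.pathLaw i (B ∩ {w | w 1 = p}) := by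
  have h := tsum_measure_preimage_singleton (μ := (M.pathLaw i).restrict B)
    (Set.to_countable (Set.univ : Set (ℤ × E))) (f := fun w : ℕ → ℤ × E => w 1)
    fun p _ => measurableSet_eq_step p
  rw [Set.preimage_univ, Measure.restrict_apply_univ, tsum_univ (f := fun p =>
    (M.pathLaw i).restrict B ((fun w : ℕ → ℤ × E => w 1) ⁻¹' {p}))] at h
  rw [← h]
  refine tsum_congr fun p => ?_
  rw [Set.inter_comm]
  exact Measure.restrict_apply (measurableSet_eq_step p)

variable (M) in
theorem tsum_pathLaw_eq_step (i : E) : ∑' p : ℤ × E, M.pathLaw i {w | w 1 = p} = 1 := by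
  rw [← measure_univ (μ := M.pathLaw i), M.tsum_pathLaw_step i Set.univ]
  simp only [Set.univ_inter]

-- Harmonicity: after a first step `p`, the recentred path must have its extreme limit at `z - p.1`.
variable (M) in
theorem pathLaw_extremeLimit (σ z : ℤ) (i : E) :
    M.pathLaw i (extremeLimit E σ z) =
      ∑' p : ℤ × E, M.pathLaw i {w | w 1 = p} * M.pathLaw p.2 (extremeLimit E σ (z - p.1)) := by
  rw [M.tsum_pathLaw_step i]
  refine tsum_congr fun p => ?_
  have hB : MeasurableSet[history E 1] {w : ℕ → ℤ × E | w 1 = p} :=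
    (le_iSup₂_of_le (f := fun k (_ : k ≤ 1) =>
      MeasurableSpace.comap (fun w : ℕ → ℤ × E => w k) inferInstance) 1 le_rfl le_rfl :
      MeasurableSpace.comap (fun w : ℕ → ℤ × E => w 1) inferInstance ≤ history E 1) _
      ⟨{p}, measurableSet_singleton p, rfl⟩
  have h := M.pathLaw_markov i 1 p.2 hB (measurableSet_extremeLimit σ (z - p.1))
  have e : {w : ℕ → ℤ × E | w 1 = p} ∩ {w | (w 1).2 = p.2} = {w | w 1 = p} :=
    Set.inter_eq_left.2 fun w (hw : w 1 = p) => congrArg Prod.snd hw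
  rw [e] at h
  rw [← h, Set.inter_comm]
  congr 1
  ext w
  refine and_congr_right fun (hw : w 1 = p) => ?_
  rw [Set.mem_preimage, recenter_one_mem_extremeLimit, hw, sub_add_cancel]

theorem exists_step_pos {i j : E} (h : 0 < M.P i j) :
    ∃ d : ℤ, M.pathLaw i {w | w 1 = (d, j)} ≠ 0 := by
  by_contra! hcon
  have h1 : M.pathLaw i {w | (w 1).2 = j} = 0 := by
    refine measure_mono_null (t := ⋃ d : ℤ, {w | w 1 = (d, j)}) (fun w hw => ?_)
      (measure_iUnion_null hcon)
    exact Set.mem_iUnion.2 ⟨(w 1).1, Prod.ext rfl hw⟩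
  rw [← ofReal_P, ENNReal.ofReal_eq_zero] at h1
  exact absurd h (not_lt.2 h1)

-- For a fixed phase the events are disjoint in `z`, so the total mass is at most the number of
-- phases. A summable family with a positive value attains its maximum, and only finitely often.
omit [MeasurableSingletonClass E] in
theorem exists_mode {σ : ℤ} (hσ : σ ≠ 0) {q : ℤ × E}
    (hq : M.pathLaw q.2 (extremeLimit E σ q.1) ≠ 0) :
    ∃ θ : ℝ≥0∞, θ ≠ ⊤ ∧ (∀ p : ℤ × E, M.pathLaw p.2 (extremeLimit E σ p.1) ≤ θ) ∧
      {p : ℤ × E | M.pathLaw p.2 (extremeLimit E σ p.1) = θ}.Finite ∧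
      {p : ℤ × E | M.pathLaw p.2 (extremeLimit E σ p.1) = θ}.Nonempty := by
  set F : ℤ × E → ℝ≥0∞ := fun p => M.pathLaw p.2 (extremeLimit E σ p.1) with hF
  have hsum : ∑' p, F p ≠ ⊤ := by
    rw [← (Equiv.prodComm E ℤ).tsum_eq]
    change ∑' c : E × ℤ, F (c.2, c.1) ≠ ⊤
    rw [ENNReal.tsum_prod (f := fun j z => F (z, j)), tsum_fintype]
    refine ENNReal.sum_ne_top.2 fun j _ => ne_top_of_le_ne_top ENNReal.one_ne_top ?_
    refine (tsum_meas_le_meas_iUnion_of_disjoint (M.pathLaw j)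
      (fun z => measurableSet_extremeLimit σ z) fun y z hyz => ?_).trans prob_le_one
    exact Set.disjoint_left.2 fun w hy hz => hyz (eq_of_mem_extremeLimit hσ hy hz)
  have hfin := ENNReal.finite_const_le_of_tsum_ne_top hsum hq
  obtain ⟨p, hp, hmax⟩ := Set.exists_max_image _ F hfin ⟨q, le_refl (F q)⟩
  have hmax' : ∀ r, F r ≤ F p := by
    intro r
    rcases le_total (F q) (F r) with h | h
    · exact hmax r h
    · exact h.trans hp
  exact ⟨F p, measure_ne_top _ _, hmax', hfin.subset fun r hr => hp.trans (Eq.ge hr), ⟨p, rfl⟩⟩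

/-- If the lower (or upper) limit of the level is finite with positive probability, then the
level is a function of the phase. -/
theorem isDegenerate_of_extremeLimit (hirr : M.P.IsIrreducible) {σ : ℤ} (hσ : σ ≠ 0) {z : ℤ}
    {i : E} (h : M.pathLaw i (extremeLimit E σ z) ≠ 0) : M.IsDegenerate := by
  obtain ⟨θ, hθ, hle, hfin, ⟨q, hq⟩⟩ := exists_mode (q := (z, i)) hσ h
  set K : E → Set ℤ := fun j => {z | M.pathLaw j (extremeLimit E σ z) = θ} with hK
  have hKfin : ∀ j, (K j).Finite := fun j =>
    (hfin.preimage (f := fun z : ℤ => (z, j)) (Function.Injective.injOn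
      fun a b hab => congrArg Prod.fst hab) : _)
  -- Maximum principle: an average of values at most `θ` equals `θ` only if every possible step
  -- leads to the value `θ`.
  have hstep : ∀ j z, z ∈ K j → ∀ p : ℤ × E, M.pathLaw j {w | w 1 = p} ≠ 0 →
      z - p.1 ∈ K p.2 := by
    intro j z hz p hp
    by_contra hcon
    have hlt := lt_of_le_of_ne (hle (z - p.1, p.2)) hcon
    have h1 := M.pathLaw_extremeLimit σ z j
    rw [show M.pathLaw j (extremeLimit E σ z) = θ from hz] at h1
    have h2 : ∑' p : ℤ × E, M.pathLaw j {w | w 1 = p} *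
        M.pathLaw p.2 (extremeLimit E σ (z - p.1)) < ∑' p : ℤ × E, M.pathLaw j {w | w 1 = p} * θ :=
      ENNReal.tsum_lt_tsum (h1 ▸ hθ) (fun r => mul_le_mul_right (hle (z - r.1, r.2)) _)
        (ENNReal.mul_lt_mul_right hp (measure_ne_top _ _) hlt)
    rw [ENNReal.tsum_mul_right, M.tsum_pathLaw_eq_step, one_mul, ← h1] at h2
    exact lt_irrefl _ h2
  have hne : ∀ j, (K j).Nonempty := by
    refine hirr.mem_of_closed (S := {j | (K j).Nonempty}) ⟨q.2, q.1, hq⟩ ?_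
    rintro j ⟨z, hz⟩ k hjk
    obtain ⟨d, hd⟩ := exists_step_pos hjk
    exact ⟨_, hstep j z hz _ hd⟩
  have hcard : ∀ j, ∀ p : ℤ × E, M.pathLaw j {w | w 1 = p} ≠ 0 →
      (K j).ncard ≤ (K p.2).ncard := fun j p hp =>
    Set.ncard_le_ncard_of_injOn (fun z => z - p.1) (fun z hz => hstep j z hz p hp)
      (fun a _ b _ hab => sub_left_injective hab) (hKfin _)
  -- The cardinality cannot decrease along a transition, so the phases of largest cardinality form a
  -- closed set.
  have hconst : ∀ j k, (K j).ncard = (K k).ncard := by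
    have : Nonempty E := ⟨i⟩
    obtain ⟨m, hm⟩ := Finite.exists_max fun j => (K j).ncard
    have key : ∀ j, j ∈ {j | (K j).ncard = (K m).ncard} := by
      refine hirr.mem_of_closed ⟨m, rfl⟩ ?_
      intro a ha b hab
      obtain ⟨d, hd⟩ := exists_step_pos hab
      exact le_antisymm (hm b) (le_trans (Eq.ge ha) (hcard a _ hd))
    exact fun j k => (key j).trans (key k).symm
  -- Injective translations between finite sets of equal size are bijective, so each possible step
  -- carries the largest element of one fibre to that of the next; this determines the step.
  choose g hgK hgmax using fun j => Set.exists_max_image (K j) id (hKfin j) (hne j)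
  have hg : ∀ j, ∀ p : ℤ × E, M.pathLaw j {w | w 1 = p} ≠ 0 → p.1 = g j - g p.2 := by
    intro j p hp
    have h1 : g j - p.1 ≤ g p.2 := hgmax p.2 _ (hstep j _ (hgK j) p hp)
    have himg : (fun z => z - p.1) '' K j = K p.2 := by
      refine Set.eq_of_subset_of_ncard_le ?_ ?_ (hKfin _)
      · rintro _ ⟨z, hz, rfl⟩
        exact hstep j z hz p hp
      · rw [Set.ncard_image_of_injective _ sub_left_injective]
        exact (hconst _ _).le
    obtain ⟨z, hz, hzg⟩ := himg.ge (hgK p.2)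
    have h2 : z ≤ g j := hgmax j z hz
    simp only at hzg
    omega
  -- A step upwards lowers the limit relative to the current level, hence the sign.
  refine ⟨fun j => -g j, fun j => ?_⟩
  have hae : ∀ᵐ w ∂M.pathLaw j, (w 1).1 = g j - g (w 1).2 := by
    have : ∀ᵐ w ∂M.pathLaw j, ∀ p : ℤ × E, w 1 = p → p.1 = g j - g p.2 := by
      rw [ae_all_iff]
      intro p
      by_cases hp : M.pathLaw j {w | w 1 = p} = 0
      · filter_upwards [measure_eq_zero_iff_ae_notMem.1 hp] with w hw h
        exact absurd h hw
      · exact ae_of_all _ fun _ _ => hg j p hp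
    exact this.mono fun w hw => hw _ rfl
  filter_upwards [M.ae_law_path 0 j hae, M.start 0 j] with ω h1 h2
  rw [h2.2]
  have h3 : M.X 1 ω - M.X 0 ω = g j - g (M.J 1 ω) := h1
  rw [h3]
  ring

/-- A nondegenerate chain whose level grows sublinearly oscillates. -/
theorem ae_frequently_lt_of_sublinear (hirr : M.P.IsIrreducible)
    (hπ : IsStationaryDistribution M.P π)
    (h : ∀ᵐ w ∂M.mixedLaw π, Tendsto (fun n : ℕ => ((w n).1 : ℝ) / n) atTop (𝓝 0))
    (hdeg : ¬ M.IsDegenerate) {σ : ℤ} (hσ : σ = 1 ∨ σ = -1) (i : E) :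
    ∀ᵐ w ∂M.pathLaw i, ∀ L, ∃ᶠ n in atTop, σ * (w n).1 < L := by
  have h1 : ∀ᵐ w ∂M.pathLaw i, ∀ z, w ∉ extremeLimit E σ z := by
    rw [ae_all_iff]
    intro z
    by_contra hcon
    have hσ0 : σ ≠ 0 := by rcases hσ with rfl | rfl <;> decide
    exact hdeg (isDegenerate_of_extremeLimit hirr hσ0 (i := i) (z := z) fun h0 =>
      hcon (measure_eq_zero_iff_ae_notMem.1 h0))
  filter_upwards [h1, ae_pathLaw_of_ae_mixedLaw hirr hπ (ae_not_tendsto_of_sublinear hirr hπ h σ) i]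
    with w hw1 hw2
  -- A limit `z` of `σ` times the level is a limit `σ * z` of the level, as `σ * σ = 1`.
  refine frequently_lt_of_not_tendsto hw2 fun z hz => hw1 (σ * z) ?_
  have hσσ : σ * σ = 1 := by rcases hσ with rfl | rfl <;> rfl
  refine ⟨hz.1.mono fun n hn => ?_, hz.2.mono fun n hn => ?_⟩
  · rw [← hn, ← mul_assoc, hσσ, one_mul]
  · rwa [← mul_assoc, hσσ, one_mul]

end MarkovAdditiveChain

/-! ### Slopes at 1 of power series with nonnegative coefficients -/

section PowerSeries

/-- The slope of a power series with nonnegative coefficients `b`, at `1`. -/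
theorem slope_tsum_pow {b : ℕ → ℝ} (h1 : Summable b) {z : ℝ} (hz : z ≠ 1)
    (hs : Summable fun m => z ^ m * b m) :
    HasSum (fun m => (∑ l ∈ Finset.range m, z ^ l) * b m)
      (slope (fun z => ∑' m, z ^ m * b m) 1 z) := by
  have h := (hs.hasSum.sub h1.hasSum).div_const (z - 1)
  have e : (fun m => (∑ l ∈ Finset.range m, z ^ l) * b m) =
      fun m => (z ^ m * b m - b m) / (z - 1) := by
    funext m
    rw [geom_sum_eq hz m]
    ring
  rw [e, slope_def_field]
  simpa using h

variable {b : ℕ → ℝ} {D : Set ℝ}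

/-- Supplies the dominating point for dominated convergence: a point above 1 if `D` has one, and 1
itself otherwise. One-sided and two-sided limits are thus treated together. -/
theorem exists_bound_of_mem (h1 : 1 ∈ D) : ∃ z₀ ∈ D, 1 ≤ z₀ ∧
    ((∃ z ∈ D, 1 < z) → 1 < z₀) ∧ ∀ᶠ z in 𝓝[D] 1, z ≤ z₀ := by
  by_cases h : ∃ z ∈ D, 1 < z
  · obtain ⟨z, hz, hz1⟩ := h
    exact ⟨z, hz, hz1.le, fun _ => hz1,
      (eventually_le_nhds hz1).filter_mono nhdsWithin_le_nhds⟩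
  · refine ⟨1, h1, le_rfl, fun h' => absurd h' h, ?_⟩
    filter_upwards [self_mem_nhdsWithin] with z hz
    by_contra hcon
    exact h ⟨z, hz, not_le.1 hcon⟩

theorem tendsto_tsum_pow (hb : ∀ m, 0 ≤ b m) (h1 : 1 ∈ D)
    (hD : ∀ z ∈ D, 0 < z ∧ Summable fun m => z ^ m * b m) :
    Tendsto (fun z => ∑' m, z ^ m * b m) (𝓝[D] 1) (𝓝 (∑' m, b m)) := by
  obtain ⟨z₀, hz₀, h1z, -, hev⟩ := exists_bound_of_mem h1
  refine tendsto_tsum_of_dominated_convergence (bound := fun m => z₀ ^ m * b m) (hD z₀ hz₀).2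
    (fun m => ?_) ?_
  · have : Tendsto (fun z : ℝ => z ^ m * b m) (𝓝 1) (𝓝 (1 ^ m * b m)) :=
      Continuous.tendsto (by fun_prop) 1
    rw [one_pow, one_mul] at this
    exact this.mono_left nhdsWithin_le_nhds
  · filter_upwards [hev, self_mem_nhdsWithin] with z hz hzD m
    have hz0 := (hD z hzD).1
    rw [Real.norm_of_nonneg (mul_nonneg (pow_nonneg hz0.le m) (hb m))]
    exact mul_le_mul_of_nonneg_right (pow_le_pow_left₀ hz0.le hz m) (hb m)

theorem tendsto_sum_pow_mul (m : ℕ) (c : ℝ) {s : Set ℝ} :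
    Tendsto (fun z : ℝ => (∑ l ∈ Finset.range m, z ^ l) * c) (𝓝[s] 1) (𝓝 (m * c)) := by
  have : Tendsto (fun z : ℝ => (∑ l ∈ Finset.range m, z ^ l) * c) (𝓝 1)
      (𝓝 ((∑ l ∈ Finset.range m, (1 : ℝ) ^ l) * c)) := Continuous.tendsto (by fun_prop) 1
  simp only [one_pow, Finset.sum_const, Finset.card_range, nsmul_eq_mul, mul_one] at this
  exact this.mono_left nhdsWithin_le_nhds

theorem tendsto_slope_tsum_pow (hb : ∀ m, 0 ≤ b m) (h1 : 1 ∈ D)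
    (hD : ∀ z ∈ D, 0 < z ∧ Summable fun m => z ^ m * b m) (hs : Summable fun m : ℕ => m * b m) :
    Tendsto (slope (fun z => ∑' m, z ^ m * b m) 1) (𝓝[D \ {1}] 1) (𝓝 (∑' m : ℕ, m * b m)) := by
  have hb1 : Summable b := by simpa using (hD 1 h1).2
  obtain ⟨z₀, hz₀, h1z, hz₀1, hev⟩ := exists_bound_of_mem h1
  have hbound : Summable fun m => (∑ l ∈ Finset.range m, z₀ ^ l) * b m := by
    -- For `z₀ = 1` the bound is the moment series; for `z₀ > 1` it is the convergent slope series
    -- at `z₀`.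
    rcases h1z.eq_or_lt with h | h
    · rw [← h]; simpa using hs
    · exact (slope_tsum_pow hb1 h.ne' (hD z₀ hz₀).2).summable
  refine Tendsto.congr' (f₁ := fun z => ∑' m, (∑ l ∈ Finset.range m, z ^ l) * b m) ?_ ?_
  · filter_upwards [self_mem_nhdsWithin] with z hz
    exact (slope_tsum_pow hb1 hz.2 (hD z hz.1).2).tsum_eq
  · refine tendsto_tsum_of_dominated_convergence hbound (fun m => tendsto_sum_pow_mul m (b m)) ?_
    filter_upwards [hev.filter_mono (nhdsWithin_mono _ Set.sdiff_subset), self_mem_nhdsWithin]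
      with z hz hzD m
    have hz0 := (hD z hzD.1).1
    rw [Real.norm_of_nonneg (mul_nonneg (Finset.sum_nonneg fun l _ => pow_nonneg hz0.le l) (hb m))]
    exact mul_le_mul_of_nonneg_right
      (Finset.sum_le_sum fun l _ => pow_le_pow_left₀ hz0.le hz l) (hb m)

/-- The slope dominates each of its finite partial sums, which tend to the partial sums of the
divergent moment series. -/
theorem tendsto_slope_tsum_pow_atTop (hb : ∀ m, 0 ≤ b m) (h1 : 1 ∈ D)
    (hD : ∀ z ∈ D, 0 < z ∧ Summable fun m => z ^ m * b m) (hs : ¬ Summable fun m : ℕ => m * b m) :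
    Tendsto (slope (fun z => ∑' m, z ^ m * b m) 1) (𝓝[D \ {1}] 1) atTop := by
  have hb1 : Summable b := by simpa using (hD 1 h1).2
  rw [not_summable_iff_tendsto_nat_atTop_of_nonneg fun m =>
    mul_nonneg (Nat.cast_nonneg m) (hb m)] at hs
  rw [tendsto_atTop]
  intro C
  obtain ⟨N, hN⟩ := (hs.eventually (eventually_gt_atTop C)).exists
  have ht : Tendsto (fun z : ℝ => ∑ m ∈ Finset.range N, (∑ l ∈ Finset.range m, z ^ l) * b m)
      (𝓝[D \ {1}] 1) (𝓝 (∑ m ∈ Finset.range N, m * b m)) :=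
    tendsto_finsetSum _ fun m _ => tendsto_sum_pow_mul m (b m)
  filter_upwards [ht.eventually (lt_mem_nhds hN), self_mem_nhdsWithin] with z hz hzD
  have hz0 := (hD z hzD.1).1
  have hS := slope_tsum_pow hb1 hzD.2 (hD z hzD.1).2
  rw [← hS.tsum_eq]
  exact hz.le.trans (hS.summable.sum_le_tsum _ fun m _ =>
    mul_nonneg (Finset.sum_nonneg fun l _ => pow_nonneg hz0.le l) (hb m))

theorem slope_tsum_pow_nonneg (hb : ∀ m, 0 ≤ b m) (h1 : Summable b) {z : ℝ} (hz : z ≠ 1)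
    (hz0 : 0 < z) (hs : Summable fun m => z ^ m * b m) :
    0 ≤ slope (fun z => ∑' m, z ^ m * b m) 1 z :=
  (slope_tsum_pow h1 hz hs).nonneg fun m =>
    mul_nonneg (Finset.sum_nonneg fun l _ => pow_nonneg hz0.le l) (hb m)

end PowerSeries

/-! ### The matrix generating function and its domain -/

namespace MarkovAdditiveChain

variable {Ω E : Type*} [MeasurableSpace Ω] [MeasurableSpace E] (M : MarkovAdditiveChain Ω E)

theorem A_nonneg (m : ℤ) (i j : E) : 0 ≤ M.A m i j := measureReal_nonneg

theorem A_one_sub_succ (m : ℕ) (i j : E) :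
    M.A (1 - ((m + 1 : ℕ) : ℤ)) i j = M.A (-(m : ℤ)) i j := by
  congr 1
  push_cast
  ring_nf

theorem F_nonneg {z : ℝ} (hz : 0 < z) (i j : E) : 0 ≤ M.F z i j :=
  tsum_nonneg fun _ => mul_nonneg (zpow_nonneg hz.le _) (M.A_nonneg _ i j)

section Series

variable [MeasurableSingletonClass E] [Fintype E]

omit [Fintype E] in
theorem A_apply (m : ℤ) (i j : E) : M.A m i j = (M.pathLaw i).real {w | w 1 = (m, j)} := by
  rw [measureReal_def, M.pathLaw_apply i (measurableSet_eq_step (m, j)), A, Matrix.of_apply,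
    measureReal_def]
  congr 1
  refine measure_congr ?_
  filter_upwards [M.start 0 i] with ω hω
  refine propext ⟨fun h => ?_, fun h => ?_⟩
  · exact Prod.ext (by simp [path, h.1, hω.1]) h.2
  · have h' : (M.X 1 ω - M.X 0 ω, M.J 1 ω) = (m, j) := h
    rw [hω.1, sub_zero] at h'
    exact ⟨congrArg Prod.fst h', congrArg Prod.snd h'⟩

theorem ofReal_A (m : ℤ) (i j : E) :
    ENNReal.ofReal (M.A m i j) = M.pathLaw i {w | w 1 = (m, j)} := by
  rw [A_apply, ofReal_measureReal]

variable {M}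

theorem ae_pathLaw_le_one (hskip : M.IsUpwardSkipFree) (i : E) :
    ∀ᵐ w ∂M.pathLaw i, (w 1).1 ≤ 1 := by
  have : ∀ᵐ w ∂M.pathLaw i, ∀ p : ℤ × E, 2 ≤ p.1 → w 1 ≠ p := by
    rw [ae_all_iff]
    intro p
    by_cases hp : 2 ≤ p.1
    · have h0 : M.pathLaw i {w | w 1 = p} = 0 := by
        rw [← ofReal_A, hskip p.1 hp]; simp
      filter_upwards [measure_eq_zero_iff_ae_notMem.1 h0] with w hw _ using hw
    · exact ae_of_all _ fun _ h => absurd h hp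
  filter_upwards [this] with w hw
  by_contra hcon
  exact hw (w 1) (by omega) rfl

/-- Skip-freeness means that the first level is almost surely `1 - k` with `k : ℕ`, so no mass is
missed. -/
theorem hasSum_A (hskip : M.IsUpwardSkipFree) (i j : E) :
    HasSum (fun k : ℕ => M.A (1 - (k : ℤ)) i j) (M.P i j) := by
  have h1 : M.pathLaw i {w | (w 1).2 = j} =
      ∑' k : ℕ, M.pathLaw i {w | w 1 = (1 - (k : ℤ), j)} := by
    rw [← measure_iUnion]
    · refine measure_congr ?_
      filter_upwards [ae_pathLaw_le_one hskip i] with w hw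
      refine propext ⟨fun h => ?_, fun h => ?_⟩
      · refine Set.mem_iUnion.2 ⟨(1 - (w 1).1).toNat, Prod.ext ?_ h⟩
        simp only
        omega
      · obtain ⟨k, hk⟩ := Set.mem_iUnion.1 h
        exact congrArg Prod.snd hk
    · intro k l hkl
      refine Set.disjoint_left.2 fun w hk hl => hkl ?_
      have h : (1 - (k : ℤ), j) = (1 - (l : ℤ), j) := Eq.trans (Eq.symm hk) hl
      have := congrArg Prod.fst h
      simp only at this
      omega
    · exact fun k => measurableSet_eq_step _
  rw [P_apply, measureReal_def, h1, ENNReal.tsum_toReal_eq fun k => measure_ne_top _ _]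
  simp only [A_apply, measureReal_def]
  exact ENNReal.hasSum_toReal (h1 ▸ measure_ne_top _ _)

/-- The part of the entries of `F(z)` with nonnegative exponents. -/
noncomputable def downSeries (M : MarkovAdditiveChain Ω E) (i j : E) (z : ℝ) : ℝ :=
  ∑' m : ℕ, z ^ m * M.A (-(m : ℤ)) i j

theorem zpow_succ_sub_one (z : ℝ) (m : ℕ) : z ^ (((m + 1 : ℕ) : ℤ) - 1) = z ^ m := by
  rw [show ((m + 1 : ℕ) : ℤ) - 1 = (m : ℤ) by push_cast; ring, zpow_natCast]

omit [MeasurableSingletonClass E] [Fintype E] in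
theorem summable_of_mem_domF {z : ℝ} (hz : z ∈ M.domF) (i j : E) :
    Summable fun m : ℕ => z ^ m * M.A (-(m : ℤ)) i j := by
  have h := (summable_nat_add_iff 1).2 (hz.2 i j)
  simpa only [A_one_sub_succ, zpow_succ_sub_one] using h

omit [MeasurableSingletonClass E] [Fintype E] in
theorem F_apply_of_mem_domF {z : ℝ} (hz : z ∈ M.domF) (i j : E) :
    M.F z i j = z⁻¹ * M.A 1 i j + M.downSeries i j z := by
  rw [F, Matrix.of_apply, (hz.2 i j).tsum_eq_zero_add]
  simp only [A_one_sub_succ, zpow_succ_sub_one, downSeries]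
  simp

theorem Ioc_subset_domF (hskip : M.IsUpwardSkipFree) : Set.Ioc 0 1 ⊆ M.domF := by
  intro z hz
  refine ⟨hz.1, fun i j => (summable_nat_add_iff 1).1 ?_⟩
  simp only [A_one_sub_succ, zpow_succ_sub_one]
  have h := (summable_nat_add_iff 1).2 (hasSum_A hskip i j).summable
  simp only [A_one_sub_succ] at h
  refine Summable.of_nonneg_of_le (fun m => mul_nonneg (pow_nonneg hz.1.le m) (M.A_nonneg _ i j))
    (fun m => ?_) h
  exact mul_le_of_le_one_left (M.A_nonneg _ i j) (pow_le_one₀ hz.1.le hz.2)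

theorem one_mem_domF (hskip : M.IsUpwardSkipFree) : (1 : ℝ) ∈ M.domF :=
  Ioc_subset_domF hskip ⟨one_pos, le_rfl⟩

theorem F_one (hskip : M.IsUpwardSkipFree) : M.F 1 = M.P := by
  ext i j
  rw [F, Matrix.of_apply]
  simpa using (hasSum_A hskip i j).tsum_eq

/-- A positive entry of `P` has a positive summand `A (1 - k)`, hence gives a positive entry of `F
z`; paths transfer with their length. -/
theorem F_isIrreducible (hirr : M.P.IsIrreducible) (hskip : M.IsUpwardSkipFree) {z : ℝ}
    (hz : z ∈ M.domF) : (M.F z).IsIrreducible := by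
  classical
  have hpos : ∀ i j, 0 < M.P i j → 0 < M.F z i j := by
    intro i j h
    obtain ⟨k, hk⟩ : ∃ k : ℕ, M.A (1 - (k : ℤ)) i j ≠ 0 := by
      by_contra! hcon
      have h0 := (hasSum_A hskip i j).tsum_eq
      simp only [hcon, tsum_zero] at h0
      exact h.ne h0
    refine (hz.2 i j).tsum_pos (fun k => mul_nonneg (zpow_nonneg hz.1.le _) (M.A_nonneg _ i j)) k ?_
    exact mul_pos (zpow_pos hz.1 _) (lt_of_le_of_ne (M.A_nonneg _ i j) (Ne.symm hk))
  refine ⟨M.F_nonneg hz.1, fun i j => ?_⟩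
  let _ : Quiver E := toQuiver M.P
  obtain ⟨p, hp⟩ := hirr.connected i j
  have key : ∀ (j : E) (p : Quiver.Path i j),
      ∃ q : @Quiver.Path E (toQuiver (M.F z)) i j, @Quiver.Path.length E (toQuiver (M.F z)) i j q
        = p.length := by
    intro j p
    induction p with
    | nil => exact ⟨@Quiver.Path.nil E (toQuiver (M.F z)) i, rfl⟩
    | cons r e ih =>
      obtain ⟨q, hq⟩ := ih
      exact ⟨@Quiver.Path.cons E (toQuiver (M.F z)) _ _ _ q ⟨hpos _ _ e.down⟩,
        congrArg Nat.succ hq⟩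
  obtain ⟨q, hq⟩ := key j p
  exact ⟨q, hq ▸ hp⟩

theorem tendsto_F (hskip : M.IsUpwardSkipFree) (i j : E) :
    Tendsto (fun z => M.F z i j) (𝓝[M.domF] 1) (𝓝 (M.P i j)) := by
  have h1 := one_mem_domF hskip
  rw [← F_one hskip, F_apply_of_mem_domF h1]
  refine Tendsto.congr' (f₁ := fun z => z⁻¹ * M.A 1 i j + M.downSeries i j z) ?_ ?_
  · filter_upwards [self_mem_nhdsWithin] with z hz
    exact (F_apply_of_mem_domF hz i j).symm
  · refine Tendsto.add (Tendsto.mul_const _ ?_) ?_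
    · exact (tendsto_inv₀ one_ne_zero).mono_left nhdsWithin_le_nhds
    · have := tendsto_tsum_pow (fun m => M.A_nonneg (-(m : ℤ)) i j) h1
        fun z hz => ⟨hz.1, summable_of_mem_domF hz i j⟩
      have e : M.downSeries i j 1 = ∑' m : ℕ, M.A (-(m : ℤ)) i j := by simp [downSeries]
      rw [e]
      exact this

/-- The upward block contributes `z⁻¹ - 1 = -(z - 1) z⁻¹`. -/
theorem F_sub_eq (hskip : M.IsUpwardSkipFree) {z : ℝ} (hz : z ∈ M.domF) (hz1 : z ≠ 1) (i j : E) :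
    M.F z i j - M.P i j =
      (z - 1) * (slope (M.downSeries i j) 1 z - z⁻¹ * M.A 1 i j) := by
  have h1 := one_mem_domF hskip
  have hz0 := hz.1.ne'
  have hz1' := sub_ne_zero.2 hz1
  rw [← F_one hskip, F_apply_of_mem_domF h1, F_apply_of_mem_domF hz, slope_def_field]
  field_simp
  ring

end Series

/-! ### The Perron–Frobenius eigenvalue near 1 -/

section Eigenvalue

variable [MeasurableSingletonClass E] [Fintype E] [DecidableEq E] [Nonempty E]
  {M : MarkovAdditiveChain Ω E} {π : E → ℝ}

theorem exists_eigenvector (hirr : M.P.IsIrreducible) (hskip : M.IsUpwardSkipFree) {z : ℝ}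
    (hz : z ∈ M.domF) :
    ∃ v : E → ℝ, (∀ i, 0 < v i) ∧ ∑ i, v i = 1 ∧ M.F z *ᵥ v = M.κ z • v := by
  have hF := F_isIrreducible hirr hskip hz
  obtain ⟨r, v, hv, hv1, h⟩ := hF.exists_pos_eigenvector
  refine ⟨v, hv, hv1, ?_⟩
  rw [κ, perronFrobeniusEigenvalue_eq hF.nonneg hv h, h]

theorem hasEigenvalue_κ (hirr : M.P.IsIrreducible) (hskip : M.IsUpwardSkipFree) {z : ℝ}
    (hz : z ∈ M.domF) : Module.End.HasEigenvalue (Matrix.toLin' (M.F z)) (M.κ z) := by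
  obtain ⟨v, hv, -, h⟩ := exists_eigenvector hirr hskip hz
  refine Module.End.hasEigenvalue_of_hasEigenvector (x := v) (Module.End.hasEigenvector_iff.2
    ⟨Module.End.mem_eigenspace_iff.2 (by simpa using h), fun h0 => ?_⟩)
  exact (hv (Classical.arbitrary E)).ne' (congrFun h0 _)

theorem κ_one (hskip : M.IsUpwardSkipFree) : M.κ 1 = 1 := by
  rw [κ, F_one hskip]
  refine perronFrobeniusEigenvalue_eq (v := fun _ => 1) M.P_nonneg (fun _ => one_pos) ?_
  ext i
  simpa [mulVec, dotProduct] using M.sum_P i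

/-- The slopes of `κ` at `1` are averages of the slopes of the entries of `F`, with weights
tending to those of the stationary distribution. -/
theorem exists_slope_κ_eq (hirr : M.P.IsIrreducible) (hskip : M.IsUpwardSkipFree)
    (hπ : IsStationaryDistribution M.P π) :
    ∃ c : ℝ → E → ℝ, (∀ z ∈ M.domF, ∀ j, 0 < c z j) ∧
      (∀ j, Tendsto (fun z => c z j) (𝓝[M.domF \ {1}] 1) (𝓝 1)) ∧
      ∀ z ∈ M.domF \ {1}, slope M.κ 1 z =
        ∑ i, ∑ j, π i * c z j * slope (M.downSeries i j) 1 z -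
          ∑ i, ∑ j, π i * c z j * (z⁻¹ * M.A 1 i j) := by
  have hex : ∀ z : ℝ, ∃ v : E → ℝ, z ∈ M.domF →
      (∀ i, 0 < v i) ∧ ∑ i, v i = 1 ∧ M.F z *ᵥ v = M.κ z • v := by
    intro z
    by_cases hz : z ∈ M.domF
    · obtain ⟨v, hv⟩ := exists_eigenvector hirr hskip hz
      exact ⟨v, fun _ => hv⟩
    · exact ⟨0, fun h => absurd h hz⟩
  choose v hv using hex
  have hπv : ∀ z ∈ M.domF, 0 < π ⬝ᵥ v z := fun z hz =>
    Finset.sum_pos (fun i _ => mul_pos (hπ.pos hirr i) ((hv z hz).1 i)) Finset.univ_nonempty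
  -- As `v z` tends to a constant vector and `π` sums to 1, each coordinate divided by the
  -- `π`-average tends to 1.
  refine ⟨fun z j => v z j / (π ⬝ᵥ v z), fun z hz j => div_pos ((hv z hz).1 j) (hπv z hz),
    fun j => ?_, fun z hz => ?_⟩
  · have hlim := tendsto_eigenvector hirr M.sum_P hπ (B := M.F) (r := M.κ) (v := v)
      (tendsto_F hskip) (by
        filter_upwards [self_mem_nhdsWithin] with z hz
        exact ⟨fun i => ((hv z hz).1 i).le, (hv z hz).2.1⟩) (by
        filter_upwards [self_mem_nhdsWithin] with z hz
        exact (hv z hz).2.2)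
    replace hlim := hlim.mono_left (nhdsWithin_mono 1 (Set.sdiff_subset (s := M.domF) (t := {1})))
    have hN : ((Fintype.card E : ℝ))⁻¹ ≠ 0 := inv_ne_zero (by simp)
    have hsum : π ⬝ᵥ (fun _ => ((Fintype.card E : ℝ))⁻¹) = ((Fintype.card E : ℝ))⁻¹ := by
      rw [dotProduct, ← Finset.sum_mul, hπ.sum_eq_one, one_mul]
    have h2 := tendsto_dotProduct (tendsto_const_nhds (x := π)) hlim
    rw [hsum] at h2
    have h3 := (tendsto_pi_nhds.1 hlim j).div h2 hN
    rwa [div_self hN] at h3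
  · have h1 := hπ.eigenvalue_sub_one_mul (hv z hz.1).2.2
    have hne := (hπv z hz.1).ne'
    have hz1 : z - 1 ≠ 0 := sub_ne_zero.2 hz.2
    have h2 : π ⬝ᵥ ((M.F z - M.P) *ᵥ v z) = (z - 1) * ∑ i, ∑ j, π i * v z j *
        (slope (M.downSeries i j) 1 z - z⁻¹ * M.A 1 i j) := by
      simp only [dotProduct, mulVec, Finset.mul_sum]
      refine Finset.sum_congr rfl fun i _ => Finset.sum_congr rfl fun j _ => ?_
      rw [Matrix.sub_apply, F_sub_eq hskip hz.1 hz.2]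
      ring
    have h3 : slope M.κ 1 z = (∑ i, ∑ j, π i * v z j *
        (slope (M.downSeries i j) 1 z - z⁻¹ * M.A 1 i j)) / (π ⬝ᵥ v z) := by
      rw [slope_def_field, κ_one hskip, eq_div_iff hne, div_mul_eq_mul_div, h1, h2,
        mul_div_cancel_left₀ _ hz1]
    rw [h3, ← Finset.sum_sub_distrib, Finset.sum_div]
    refine Finset.sum_congr rfl fun i _ => ?_
    rw [← Finset.sum_sub_distrib, Finset.sum_div]
    refine Finset.sum_congr rfl fun j _ => ?_
    ring

end Eigenvalue

end MarkovAdditiveChain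

/-! ### Arithmetic of extended reals -/

section EReal

theorem EReal.sum_coe_sub_coe {ι : Type*} (s : Finset ι) {u d : ι → ℝ≥0∞} :
    ∑ i ∈ s, ((u i : EReal) - (d i : EReal)) =
      ((∑ i ∈ s, u i : ℝ≥0∞) : EReal) - ((∑ i ∈ s, d i : ℝ≥0∞) : EReal) := by
  classical
  induction s using Finset.induction_on with
  | empty => simp
  | insert a s ha ih =>
    rw [Finset.sum_insert ha, Finset.sum_insert ha, Finset.sum_insert ha, ih]
    simp only [EReal.coe_ennreal_add, sub_eq_add_neg]
    rw [EReal.neg_add (Or.inl (EReal.coe_ennreal_ne_bot _)) (Or.inr (EReal.coe_ennreal_ne_bot _)),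
      sub_eq_add_neg, add_add_add_comm]

theorem EReal.coe_mul_sub_coe {p : ℝ} (hp : 0 ≤ p) (u d : ℝ≥0∞) :
    (p : EReal) * ((u : EReal) - (d : EReal)) =
      ((ENNReal.ofReal p * u : ℝ≥0∞) : EReal) - ((ENNReal.ofReal p * d : ℝ≥0∞) : EReal) := by
  rw [sub_eq_add_neg, EReal.left_distrib_of_nonneg_of_ne_top (EReal.coe_nonneg.2 hp)
    (EReal.coe_ne_top p), mul_neg, ← sub_eq_add_neg, EReal.coe_ennreal_mul, EReal.coe_ennreal_mul,
    EReal.coe_ennreal_ofReal, max_eq_left hp]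

theorem EReal.coe_ennreal_sub_coe_neg_iff (D : ℝ≥0∞) (u : ℝ) :
    (D : EReal) - (u : EReal) < 0 ↔ D < ENNReal.ofReal u := by
  induction D with
  | top => simp
  | coe d =>
    have h : ((d : ℝ≥0∞) : EReal) - (u : EReal) = ((d - u : ℝ) : EReal) := rfl
    rw [h, ENNReal.ofReal, ENNReal.coe_lt_coe, Real.lt_toNNReal_iff_coe_lt, EReal.coe_neg',
      sub_lt_zero]

/-- The sign condition matters: `ENNReal.ofReal` sends negative `u` to 0, so the equivalence would
fail at `D = 0`. -/
theorem EReal.coe_ennreal_sub_coe_eq_zero_iff (D : ℝ≥0∞) {u : ℝ} (hu : 0 ≤ u) :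
    (D : EReal) - (u : EReal) = 0 ↔ ENNReal.ofReal u = D := by
  induction D with
  | top => simp
  | coe d =>
    have h : ((d : ℝ≥0∞) : EReal) - (u : EReal) = ((d - u : ℝ) : EReal) := rfl
    rw [h, ENNReal.ofReal, ENNReal.coe_inj, ← NNReal.coe_inj, Real.coe_toNNReal u hu,
      EReal.coe_eq_zero, sub_eq_zero, eq_comm]

theorem EReal.coe_ennreal_sub_coe_pos_iff (D : ℝ≥0∞) {u : ℝ} (hu : 0 ≤ u) :
    0 < (D : EReal) - (u : EReal) ↔ ENNReal.ofReal u < D := by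
  rw [← not_le, ← not_le, le_iff_lt_or_eq, le_iff_lt_or_eq, coe_ennreal_sub_coe_neg_iff D u,
    coe_ennreal_sub_coe_eq_zero_iff D hu, eq_comm (a := D)]

end EReal

/-! ### First moments and the derivative of κ at 1 -/

namespace MarkovAdditiveChain

variable {Ω E : Type*} [MeasurableSpace Ω] [MeasurableSpace E]

/-- The entries of `∑_{m ≥ 0} m A_{-m}`. -/
noncomputable def downMoment (M : MarkovAdditiveChain Ω E) (i j : E) : ℝ≥0∞ :=
  ∑' m : ℕ, ENNReal.ofReal (m * M.A (-(m : ℤ)) i j)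

theorem summable_of_downMoment_ne_top {M : MarkovAdditiveChain Ω E} {i j : E}
    (h : M.downMoment i j ≠ ⊤) : Summable fun m : ℕ => m * M.A (-(m : ℤ)) i j := by
  refine (ENNReal.summable_toReal h).congr fun m => ?_
  rw [ENNReal.toReal_ofReal (mul_nonneg (Nat.cast_nonneg m) (M.A_nonneg _ i j))]

variable [Fintype E]

theorem meanDown_eq (M : MarkovAdditiveChain Ω E) {π : E → ℝ} (hπ : ∀ i, 0 ≤ π i) :
    M.meanDown π = ∑ i, ∑ j, ENNReal.ofReal (π i) * M.downMoment i j := by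
  have h : ∀ m : ℕ, (m : ℝ≥0∞) * ENNReal.ofReal (π ⬝ᵥ (M.A (-(m : ℤ)) *ᵥ 1)) =
      ∑ i, ∑ j, ENNReal.ofReal (π i) * ENNReal.ofReal (m * M.A (-(m : ℤ)) i j) := by
    intro m
    have e : π ⬝ᵥ (M.A (-(m : ℤ)) *ᵥ 1) = ∑ i, ∑ j, π i * M.A (-(m : ℤ)) i j := by
      simp [dotProduct, mulVec, Finset.mul_sum]
    rw [e, ENNReal.ofReal_sum_of_nonneg fun i _ => Finset.sum_nonneg fun j _ =>
      mul_nonneg (hπ i) (M.A_nonneg _ i j), Finset.mul_sum]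
    refine Finset.sum_congr rfl fun i _ => ?_
    rw [ENNReal.ofReal_sum_of_nonneg fun j _ => mul_nonneg (hπ i) (M.A_nonneg _ i j),
      Finset.mul_sum]
    refine Finset.sum_congr rfl fun j _ => ?_
    rw [ENNReal.ofReal_mul (hπ i), ENNReal.ofReal_mul (Nat.cast_nonneg m), ENNReal.ofReal_natCast]
    ring
  simp only [meanDown, h, downMoment, ← ENNReal.tsum_mul_left]
  rw [Summable.tsum_finsetSum fun i _ => ENNReal.summable]
  refine Finset.sum_congr rfl fun i _ => ?_
  rw [Summable.tsum_finsetSum fun i _ => ENNReal.summable]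

theorem meanUp_eq (M : MarkovAdditiveChain Ω E) (π : E → ℝ) :
    M.meanUp π = ∑ i, ∑ j, π i * M.A 1 i j := by
  simp [meanUp, dotProduct, mulVec, Finset.mul_sum]

theorem meanUp_nonneg (M : MarkovAdditiveChain Ω E) {π : E → ℝ} (hπ : ∀ i, 0 ≤ π i) :
    0 ≤ M.meanUp π := by
  rw [meanUp_eq]
  exact Finset.sum_nonneg fun i _ => Finset.sum_nonneg fun j _ =>
    mul_nonneg (hπ i) (M.A_nonneg _ i j)

variable [MeasurableSingletonClass E] {M : MarkovAdditiveChain Ω E} {π : E → ℝ}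

/-- The derivative of `κ` at `1`. -/
theorem hasExtDerivWithinAt_κ [DecidableEq E] [Nonempty E] (hirr : M.P.IsIrreducible)
    (hskip : M.IsUpwardSkipFree) (hπ : IsStationaryDistribution M.P π) :
    HasExtDerivWithinAt M.κ (M.driftSum π) M.domF 1 := by
  obtain ⟨c, hc0, hc, hslope⟩ := exists_slope_κ_eq hirr hskip hπ
  have h1 := one_mem_domF hskip
  have hD : ∀ i j, ∀ z ∈ M.domF, 0 < z ∧ Summable fun m : ℕ => z ^ m * M.A (-(m : ℤ)) i j :=
    fun i j z hz => ⟨hz.1, summable_of_mem_domF hz i j⟩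
  have hA : ∀ i j, ∀ m : ℕ, 0 ≤ M.A (-(m : ℤ)) i j := fun i j m => M.A_nonneg _ i j
  have hA1 : ∀ i j, Summable fun m : ℕ => M.A (-(m : ℤ)) i j := fun i j => by
    simpa using (hD i j 1 h1).2
  have hup : Tendsto (fun z => ∑ i, ∑ j, π i * c z j * (z⁻¹ * M.A 1 i j)) (𝓝[M.domF \ {1}] 1)
      (𝓝 (M.meanUp π)) := by
    rw [meanUp_eq]
    refine tendsto_finsetSum _ fun i _ => tendsto_finsetSum _ fun j _ => ?_
    have hinv : Tendsto (fun z : ℝ => z⁻¹) (𝓝[M.domF \ {1}] 1) (𝓝 1) := by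
      simpa using (tendsto_inv₀ (one_ne_zero (α := ℝ))).mono_left nhdsWithin_le_nhds
    simpa using ((hc j).const_mul (π i)).mul (hinv.mul_const (M.A 1 i j))
  rw [HasExtDerivWithinAt]
  by_cases hfin : ∀ i j, M.downMoment i j ≠ ⊤
  · have hs := fun i j => summable_of_downMoment_ne_top (hfin i j)
    have hT : ∀ i j, M.downMoment i j =
        ENNReal.ofReal (∑' m : ℕ, m * M.A (-(m : ℤ)) i j) := fun i j =>
      (ENNReal.ofReal_tsum_of_nonneg (fun m => mul_nonneg (Nat.cast_nonneg m) (hA i j m))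
        (hs i j)).symm
    have hTn : ∀ i j, 0 ≤ ∑' m : ℕ, m * M.A (-(m : ℤ)) i j := fun i j =>
      tsum_nonneg fun m => mul_nonneg (Nat.cast_nonneg m) (hA i j m)
    have hdown : M.meanDown π =
        ENNReal.ofReal (∑ i, ∑ j, π i * ∑' m : ℕ, m * M.A (-(m : ℤ)) i j) := by
      rw [M.meanDown_eq hπ.nonneg, ENNReal.ofReal_sum_of_nonneg fun i _ =>
        Finset.sum_nonneg fun j _ => mul_nonneg (hπ.nonneg i) (hTn i j)]
      refine Finset.sum_congr rfl fun i _ => ?_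
      rw [ENNReal.ofReal_sum_of_nonneg fun j _ => mul_nonneg (hπ.nonneg i) (hTn i j)]
      exact Finset.sum_congr rfl fun j _ => by rw [hT, ENNReal.ofReal_mul (hπ.nonneg i)]
    have hdrift : M.driftSum π = ((∑ i, ∑ j, π i * ∑' m : ℕ, m * M.A (-(m : ℤ)) i j -
        M.meanUp π : ℝ) : EReal) := by
      rw [driftSum, hdown, EReal.coe_ennreal_ofReal, max_eq_left (Finset.sum_nonneg fun i _ =>
        Finset.sum_nonneg fun j _ => mul_nonneg (hπ.nonneg i) (hTn i j)), EReal.coe_sub]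
    rw [hdrift]
    refine EReal.tendsto_coe.2 (Tendsto.congr' ?_ (Tendsto.sub (f := fun z =>
      ∑ i, ∑ j, π i * c z j * slope (M.downSeries i j) 1 z) ?_ hup))
    · filter_upwards [self_mem_nhdsWithin] with z hz
      exact (hslope z hz).symm
    · refine tendsto_finsetSum _ fun i _ => tendsto_finsetSum _ fun j _ => ?_
      have := ((hc j).const_mul (π i)).mul
        (tendsto_slope_tsum_pow (hA i j) h1 (hD i j) (hs i j))
      rwa [mul_one] at this
  -- One infinite moment is enough: its slope has a positive limiting weight `π a`, the other slopes
  -- are nonnegative, and the upward part converges.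
  · push Not at hfin
    obtain ⟨a, b, hab⟩ := hfin
    have hdown : M.meanDown π = ⊤ := by
      rw [M.meanDown_eq hπ.nonneg]
      refine ENNReal.sum_eq_top.2 ⟨a, Finset.mem_univ a, ENNReal.sum_eq_top.2
        ⟨b, Finset.mem_univ b, ?_⟩⟩
      rw [hab, ENNReal.mul_top (ENNReal.ofReal_pos.2 (hπ.pos hirr a)).ne']
    have hdrift : M.driftSum π = ⊤ := by
      rw [driftSum, hdown, EReal.coe_ennreal_top, EReal.top_sub_coe]
    rw [hdrift, EReal.tendsto_coe_nhds_top_iff]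
    have hns : ¬ Summable fun m : ℕ => m * M.A (-(m : ℤ)) a b := by
      intro hs
      have := ENNReal.ofReal_tsum_of_nonneg (fun m => mul_nonneg (Nat.cast_nonneg m) (hA a b m)) hs
      rw [downMoment, ← this] at hab
      exact ENNReal.ofReal_ne_top hab
    have hlim := ((hc b).const_mul (π a)).pos_mul_atTop (by simpa using hπ.pos hirr a)
      (tendsto_slope_tsum_pow_atTop (hA a b) h1 (hD a b) hns)
    refine tendsto_atTop_mono' _ ?_ (hlim.atTop_add hup.neg)
    filter_upwards [self_mem_nhdsWithin] with z hz
    rw [hslope z hz, ← sub_eq_add_neg]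
    refine sub_le_sub_right ?_ _
    have hnn : ∀ i j, 0 ≤ π i * c z j * slope (M.downSeries i j) 1 z := fun i j =>
      mul_nonneg (mul_nonneg (hπ.nonneg i) (hc0 z hz.1 j).le)
        (slope_tsum_pow_nonneg (hA i j) (hA1 i j) hz.2 hz.1.1 (hD i j z hz.1).2)
    refine le_trans ?_ (Finset.single_le_sum (f := fun i => ∑ j, π i * c z j *
      slope (M.downSeries i j) 1 z) (fun i _ => Finset.sum_nonneg fun j _ => hnn i j)
      (Finset.mem_univ a))
    exact Finset.single_le_sum (f := fun j => π a * c z j * slope (M.downSeries a j) 1 z)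
      (fun j _ => hnn a j) (Finset.mem_univ b)

end MarkovAdditiveChain

/-! ### The stationary mean and the strong law for the level -/

namespace MarkovAdditiveChain

variable {Ω E : Type*} [MeasurableSpace Ω] [MeasurableSpace E] [Fintype E]
  [MeasurableSingletonClass E] {M : MarkovAdditiveChain Ω E} {π : E → ℝ}

variable (M) in
theorem lintegral_pathLaw_level (i : E) (φ : ℝ → ℝ≥0∞) :
    ∫⁻ w, φ ((w 1).1 : ℝ) ∂M.pathLaw i =
      ∑ j, ∑' d : ℤ, φ d * ENNReal.ofReal (M.A d i j) := by
  have h1 : Measurable fun w : ℕ → ℤ × E => w 1 := measurable_pi_apply 1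
  have h := lintegral_map (μ := M.pathLaw i) (f := fun p : ℤ × E => φ (p.1 : ℝ))
    (measurable_of_countable _) h1
  rw [lintegral_countable'] at h
  rw [← h, ← (Equiv.prodComm E ℤ).tsum_eq, ENNReal.tsum_prod', tsum_fintype]
  refine Finset.sum_congr rfl fun j _ => tsum_congr fun d => ?_
  rw [ofReal_A, Measure.map_apply h1 (measurableSet_singleton _)]
  rfl

theorem lintegral_level_pos (hskip : M.IsUpwardSkipFree) (i : E) :
    ∫⁻ w, ENNReal.ofReal ((w 1).1 : ℝ) ∂M.pathLaw i = ∑ j, ENNReal.ofReal (M.A 1 i j) := by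
  rw [M.lintegral_pathLaw_level i ENNReal.ofReal]
  refine Finset.sum_congr rfl fun j _ => ?_
  rw [tsum_eq_single 1]
  · simp
  · intro d hd
    rcases lt_or_gt_of_ne hd with h | h
    · rw [ENNReal.ofReal_of_nonpos (by exact_mod_cast (by omega : d ≤ 0)), zero_mul]
    · rw [hskip d (by omega)]
      simp

theorem lintegral_level_neg (i : E) :
    ∫⁻ w, ENNReal.ofReal (-((w 1).1 : ℝ)) ∂M.pathLaw i = ∑ j, M.downMoment i j := by
  rw [M.lintegral_pathLaw_level i fun x => ENNReal.ofReal (-x)]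
  refine Finset.sum_congr rfl fun j _ => ?_
  have hinj : Function.Injective fun m : ℕ => -(m : ℤ) := fun a b h => by
    simp only at h
    omega
  rw [downMoment, ← hinj.tsum_eq]
  · refine tsum_congr fun m => ?_
    rw [ENNReal.ofReal_mul (Nat.cast_nonneg m)]
    simp
  · intro d hd
    by_contra hcon
    have h0 : 0 ≤ d := by
      by_contra hneg
      exact hcon ⟨(-d).toNat, by simp only; omega⟩
    refine hd ?_
    simp only
    rw [ENNReal.ofReal_of_nonpos (by simpa using h0), zero_mul]

variable (M) in
omit [Fintype E] [MeasurableSingletonClass E] in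
theorem extExpectation_law (i : E) :
    extExpectation (M.law 0 i) (fun ω => (M.X 1 ω : ℝ)) =
      extExpectation (M.pathLaw i) (fun w => ((w 1).1 : ℝ)) := by
  have key : ∀ φ : ℝ → ℝ≥0∞, ∫⁻ ω, φ (M.X 1 ω : ℝ) ∂M.law 0 i =
      ∫⁻ w, φ ((w 1).1 : ℝ) ∂M.pathLaw i := by
    intro φ
    have hm : Measurable fun w : ℕ → ℤ × E => φ ((w 1).1 : ℝ) :=
      (measurable_from_top (f := fun d : ℤ => φ (d : ℝ))).comp (measurable_level 1)
    rw [pathLaw, lintegral_map hm M.measurable_path]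
    refine lintegral_congr_ae ?_
    filter_upwards [M.start 0 i] with ω hω
    simp [path, hω.1]
  rw [extExpectation, extExpectation, key ENNReal.ofReal, key fun x => ENNReal.ofReal (-x)]

omit [MeasurableSingletonClass E] in
theorem lintegral_mixedLaw (φ : (ℕ → ℤ × E) → ℝ≥0∞) :
    ∫⁻ w, φ w ∂M.mixedLaw π = ∑ i, ENNReal.ofReal (π i) * ∫⁻ w, φ w ∂M.pathLaw i := by
  rw [mixedLaw, lintegral_finsetSum_measure]
  simp

theorem lintegral_mixedLaw_pos (hskip : M.IsUpwardSkipFree) (hπ : ∀ i, 0 ≤ π i) :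
    ∫⁻ w, ENNReal.ofReal ((w 1).1 : ℝ) ∂M.mixedLaw π = ENNReal.ofReal (M.meanUp π) := by
  rw [lintegral_mixedLaw, meanUp_eq, ENNReal.ofReal_sum_of_nonneg fun i _ =>
    Finset.sum_nonneg fun j _ => mul_nonneg (hπ i) (M.A_nonneg _ i j)]
  refine Finset.sum_congr rfl fun i _ => ?_
  rw [lintegral_level_pos hskip, ENNReal.ofReal_sum_of_nonneg fun j _ =>
    mul_nonneg (hπ i) (M.A_nonneg _ i j), Finset.mul_sum]
  exact Finset.sum_congr rfl fun j _ => (ENNReal.ofReal_mul (hπ i)).symm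

theorem lintegral_mixedLaw_neg (hπ : ∀ i, 0 ≤ π i) :
    ∫⁻ w, ENNReal.ofReal (-((w 1).1 : ℝ)) ∂M.mixedLaw π = M.meanDown π := by
  rw [lintegral_mixedLaw, M.meanDown_eq hπ]
  refine Finset.sum_congr rfl fun i _ => ?_
  rw [lintegral_level_neg, Finset.mul_sum]

theorem extExpectation_mixedLaw (hskip : M.IsUpwardSkipFree) (hπ : ∀ i, 0 ≤ π i) :
    extExpectation (M.mixedLaw π) (fun w => ((w 1).1 : ℝ)) = -M.driftSum π := by
  rw [extExpectation, lintegral_mixedLaw_pos hskip hπ, lintegral_mixedLaw_neg hπ, driftSum,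
    EReal.neg_sub (Or.inl (EReal.coe_ennreal_ne_bot _)) (Or.inr (EReal.coe_ne_top _)),
    EReal.coe_ennreal_ofReal, max_eq_left (M.meanUp_nonneg hπ), add_comm, sub_eq_add_neg]

theorem meanX₁_eq (hskip : M.IsUpwardSkipFree) (hπ : ∀ i, 0 ≤ π i) :
    M.meanX₁ π = -M.driftSum π := by
  rw [← extExpectation_mixedLaw hskip hπ, meanX₁]
  simp only [extExpectation_law]
  rw [extExpectation, lintegral_mixedLaw, lintegral_mixedLaw, ← EReal.sum_coe_sub_coe]
  refine Finset.sum_congr rfl fun i _ => ?_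
  rw [extExpectation, EReal.coe_mul_sub_coe (hπ i)]

/-- The strong law of large numbers. -/
theorem ae_tendsto_X_div (hirr : M.P.IsIrreducible) (hskip : M.IsUpwardSkipFree)
    (hπ : IsStationaryDistribution M.P π) (x : ℤ) (i : E) :
    ∀ᵐ ω ∂(M.law x i), Tendsto (fun n : ℕ => (((M.X n ω : ℝ) / (n : ℝ) : ℝ) : EReal)) atTop
      (𝓝 (-M.driftSum π)) := by
  have h := ae_tendsto_level_div hirr hπ
    (by rw [lintegral_mixedLaw_pos hskip hπ.nonneg]; exact ENNReal.ofReal_ne_top)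
  rw [extExpectation_mixedLaw hskip hπ.nonneg] at h
  filter_upwards [M.ae_law_path x i (ae_pathLaw_of_ae_mixedLaw hirr hπ h i)] with ω hω
  -- The path is recentred, so `X 0 / n` is added back. Its limit is the real number 0, which keeps
  -- addition continuous even when the other limit is `⊥`.
  have h0 : Tendsto (fun n : ℕ => (((M.X 0 ω : ℝ) / n : ℝ) : EReal)) atTop (𝓝 ((0 : ℝ) : EReal)) :=
    EReal.tendsto_coe.2 (tendsto_const_nhds.div_atTop tendsto_natCast_atTop_atTop)
  have hadd := (EReal.continuousAt_add (p := (-M.driftSum π, ((0 : ℝ) : EReal)))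
    (Or.inr (EReal.coe_ne_bot 0)) (Or.inr (EReal.coe_ne_top 0))).tendsto.comp (hω.prodMk_nhds h0)
  simp only [EReal.coe_zero, add_zero] at hadd
  refine hadd.congr fun n => ?_
  simp only [Function.comp, path]
  rw [← EReal.coe_add]
  congr 1
  push_cast
  ring

end MarkovAdditiveChain

/-! ### From linear growth to divergence -/

section Divergence

theorem tendsto_atTop_of_tendsto_div {x : ℕ → ℤ} {L : EReal} (hL : 0 < L)
    (h : Tendsto (fun n : ℕ => (((x n : ℝ) / (n : ℝ) : ℝ) : EReal)) atTop (𝓝 L)) :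
    Tendsto x atTop atTop := by
  obtain ⟨c, hc0, hcL⟩ := EReal.lt_iff_exists_real_btwn.1 hL
  have hc : 0 < c := by exact_mod_cast hc0
  rw [← tendsto_intCast_atTop_iff (R := ℝ)]
  refine tendsto_atTop_mono' _ ?_ (tendsto_natCast_atTop_atTop.const_mul_atTop hc)
  filter_upwards [h.eventually (lt_mem_nhds hcL), eventually_gt_atTop 0] with n hn hn0
  have h1 : c < (x n : ℝ) / n := by exact_mod_cast hn
  rw [lt_div_iff₀ (by exact_mod_cast hn0)] at h1
  exact h1.le

theorem tendsto_atBot_of_tendsto_div {x : ℕ → ℤ} {L : EReal} (hL : L < 0)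
    (h : Tendsto (fun n : ℕ => (((x n : ℝ) / (n : ℝ) : ℝ) : EReal)) atTop (𝓝 L)) :
    Tendsto x atTop atBot := by
  rw [← tendsto_neg_atTop_iff]
  refine tendsto_atTop_of_tendsto_div (L := -L) (by simpa using EReal.neg_lt_neg_iff.2 hL) ?_
  refine h.neg.congr fun n => ?_
  rw [← EReal.coe_neg, ← neg_div, Int.cast_neg]

end Divergence

/-! ### Assembly of the main theorem -/

theorem mainTheorem10 {Ω E : Type*} [MeasurableSpace Ω] [Fintype E] [DecidableEq E]
    [MeasurableSpace E] [MeasurableSingletonClass E]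
    (M : MarkovAdditiveChain Ω E) (hirr : M.P.IsIrreducible) (hskip : M.IsUpwardSkipFree)
    (π : E → ℝ) (hπ : IsStationaryDistribution M.P π) :
    Set.Ioc 0 1 ⊆ M.domF ∧
    (∀ z ∈ M.domF, Module.End.HasEigenvalue (Matrix.toLin' (M.F z)) (M.κ z)) ∧
    ∃ κ' : EReal, HasExtDerivWithinAt M.κ κ' M.domF 1 ∧
      (∀ x i, ∀ᵐ ω ∂(M.law x i),
        Tendsto (fun n : ℕ => (((M.X n ω : ℝ) / (n : ℝ) : ℝ) : EReal)) atTop (𝓝 (-κ'))) ∧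
      -κ' = M.meanX₁ π ∧
      M.meanX₁ π = -M.driftSum π ∧
      (κ' < 0 ↔ M.meanDown π < ENNReal.ofReal (M.meanUp π)) ∧
      (0 < κ' ↔ ENNReal.ofReal (M.meanUp π) < M.meanDown π) ∧
      (κ' = 0 ↔ ENNReal.ofReal (M.meanUp π) = M.meanDown π) ∧
      (κ' < 0 → ∀ x i, ∀ᵐ ω ∂(M.law x i), Tendsto (fun n => M.X n ω) atTop atTop) ∧
      (0 < κ' → ∀ x i, ∀ᵐ ω ∂(M.law x i), Tendsto (fun n => M.X n ω) atTop atBot) ∧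
      (κ' = 0 → ¬ M.IsDegenerate → ∀ x i, ∀ᵐ ω ∂(M.law x i),
        limsup (fun n => (((M.X n ω : ℤ) : ℝ) : EReal)) atTop = ⊤ ∧
        liminf (fun n => (((M.X n ω : ℤ) : ℝ) : EReal)) atTop = ⊥) := by
  have hE : Nonempty E := by
    by_contra hcon
    rw [not_nonempty_iff] at hcon
    simpa using hπ.sum_eq_one
  have hslln := MarkovAdditiveChain.ae_tendsto_X_div hirr hskip hπ
  have hmean := MarkovAdditiveChain.meanX₁_eq hskip hπ.nonneg
  have hup := M.meanUp_nonneg hπ.nonneg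
  refine ⟨MarkovAdditiveChain.Ioc_subset_domF hskip, fun z hz =>
    MarkovAdditiveChain.hasEigenvalue_κ hirr hskip hz, M.driftSum π,
    MarkovAdditiveChain.hasExtDerivWithinAt_κ hirr hskip hπ, hslln, hmean.symm, hmean,
    EReal.coe_ennreal_sub_coe_neg_iff _ _, EReal.coe_ennreal_sub_coe_pos_iff _ hup,
    EReal.coe_ennreal_sub_coe_eq_zero_iff _ hup, fun h x i => ?_, fun h x i => ?_,
    fun h hdeg x i => ?_⟩
  · filter_upwards [hslln x i] with ω hω
    exact tendsto_atTop_of_tendsto_div (by simpa using EReal.neg_lt_neg_iff.2 h) hω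
  · filter_upwards [hslln x i] with ω hω
    exact tendsto_atBot_of_tendsto_div (by simpa using EReal.neg_lt_neg_iff.2 h) hω
  · have h0 := MarkovAdditiveChain.ae_tendsto_level_div hirr hπ (by
      rw [MarkovAdditiveChain.lintegral_mixedLaw_pos hskip hπ.nonneg]
      exact ENNReal.ofReal_ne_top)
    rw [MarkovAdditiveChain.extExpectation_mixedLaw hskip hπ.nonneg, h, neg_zero] at h0
    have h1 : ∀ᵐ w ∂M.mixedLaw π, Tendsto (fun n : ℕ => ((w n).1 : ℝ) / n) atTop (𝓝 0) :=
      h0.mono fun w hw => EReal.tendsto_coe.1 hw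
    -- The case `σ = 1` yields the limit inferior and `σ = -1` the limit superior; thresholds are
    -- then shifted by `X 0`.
    filter_upwards [M.ae_law_path x i (MarkovAdditiveChain.ae_frequently_lt_of_sublinear hirr hπ h1
        hdeg (σ := 1) (Or.inl rfl) i),
      M.ae_law_path x i (MarkovAdditiveChain.ae_frequently_lt_of_sublinear hirr hπ h1
        hdeg (σ := -1) (Or.inr rfl) i)] with ω h2 h3
    refine ⟨limsup_intCast_eq_top fun L => (h3 (M.X 0 ω - L)).mono fun n hn => ?_,
      liminf_intCast_eq_bot fun L => (h2 (L - M.X 0 ω)).mono fun n hn => ?_⟩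
    · simp only [MarkovAdditiveChain.path] at hn
      linarith
    · simp only [MarkovAdditiveChain.path] at hn
      linarith
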